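/- **Setting.** Let $V$ be a finite set with $n=|V|$, and consider the complete graph on $V$ whose edges are partitioned into positive edges $E^+$ and negative edges $E^-$; $\deg^+(u)$ is the number of positive edges at $u$. The cost $\mathrm{cost}_G(\mathcal C)$ of a partition $\mathcal C$ of $V$ is the number of positive edges between different clusters plus the number of negative edges inside clusters, and $\mathrm{OPT}$ is the minimum cost of a partition. For $\beta\ge 1$, a $\beta$-level predictor is a function $d$ assigning to every unordered pair of distinct vertices a number $d_{uv}\in[0,1]$ with $d_{uw}\le d_{uv}+d_{vw}$ for all $u,v,w$ and $\sum_{uv\in E^+}d_{uv}+\sum_{uv\in E^-}(1-d_{uv})\le\beta\cdot\mathrm{OPT}$. Put $p_{uv}=f^+(d_{uv})$ if $uv\in E^+$ and $p_{uv}=f^-(d_{uv})$ if $uv\in E^-$, where $f^-(x)=x$ and, with $a=0.19$, $b=0.5095$, $f^+(x)=0$ for $x<a$, $f^+(x)=\left(\frac{x-a}{b-a}\right)^2$ for $a\le x\le b$, $f^+(x)=1$ for $x>b$. **Offline algorithm** (parameters $c>0$ and $\varepsilon\in(0,1/4)$). Draw a uniformly random bijection $\pi:V\to\{1,\dots,n\}$.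 With $\tau_u=\frac{c}{\varepsilon}\cdot\frac{n\log n}{\deg^+(u)}$ ($\tau_u=\infty$ if $\deg^+(u)=0$), call $u$ interesting if $\pi_u<\tau_u$, and uninteresting otherwise. * *TruncatedPivot.* While some interesting vertex is unclustered, let $u$ be the one of smallest rank $\pi_u$; it becomes a pivot and forms a cluster with all its unclustered interesting positive neighbours. Then each uninteresting vertex $u$ joins the cluster of the pivot $v$ of smallest rank with $uv\in E^+$ and $\pi_v<\tau_u$, if there is one. Every remaining vertex becomes a singleton cluster. * *TruncatedPivotWithPred.* The same, with the same $\pi$, except that each unclustered interesting vertex $v$ joins the cluster of the current pivot $u$ independently with probability $1-p_{uv}$; and each uninteresting vertex $u$ goes through the pivots $v$ with $\pi_v<\tau_u$ in the order of $\pi$, joining $v$ with probability $1-p_{uv}$ independently, until it has joined one. Output the cheaper of the two clusterings; call it $\mathcal C$. **Lemma.** There is a universal constant $c_0>0$ such that for all $c\ge c_0$, all $\varepsilon\in(0,1/4)$, all $\beta\ge1$, every complete graph with signed edges on a finite vertex set and every $\beta$-level predictor for it, the output $\mathcal C$ of the offline algorithm satisfies $\mathrm{OPT}\le\mathbb E[\mathrm{cost}_G(\mathcal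 C)]$ and $$\mathbb E[\mathrm{cost}_G(\mathcal C)]\le\left(\min\{2.06\beta,3\}+\varepsilon\right)\cdot\mathrm{OPT}\quad\text{if }\mathrm{OPT}\ne0,$$ $$\mathbb E[\mathrm{cost}_G(\mathcal C)]\le\frac{1+4\varepsilon}{n^{c/2-3}}\quad\text{if }\mathrm{OPT}=0.$$ The expectation is over $\pi$ and the independent coin flips. -/

import Mathlib

namespace CorrClust

/-! A complete graph whose edges are labelled `+` or `-` is given by the simple graph `G` of its
positive edges; the negative edges are the edges of the complement `Gᶜ`. A clustering, that is a
partition of the vertex set, is a `Setoid`. -/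

/-- Both endpoints of the edge `e` are in one cluster of `C`. -/
def Within {V : Type*} (C : Setoid V) (e : Sym2 V) : Prop :=
  ∀ u ∈ e, ∀ v ∈ e, C u v

open scoped Classical in
/-- The number of disagreements of the clustering `C`: positive edges between different clusters
plus negative edges inside a cluster. -/
noncomputable def cost {V : Type*} [Fintype V] (G : SimpleGraph V) (C : Setoid V) : ℕ :=
  (G.edgeFinset.filter fun e => ¬ Within C e).card + (Gᶜ.edgeFinset.filter fun e => Within C e).card

/-- The cost of an optimal clustering. -/
noncomputable def opt {V : Type*} [Fintype V] (G : SimpleGraph V) : ℕ :=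
  ⨅ C : Setoid V, cost G C

open scoped Classical in
/-- The predictor `d`, a function on unordered pairs with values in `[0,1]`, is `β`-level for `G`.
Its values on the diagonal are never used. -/
structure IsBetaLevel {V : Type*} [Fintype V] (G : SimpleGraph V) (β : ℝ)
    (d : Sym2 V → unitInterval) : Prop where
  triangle : ∀ u v w : V, u ≠ v → v ≠ w → u ≠ w →
    (d s(u, w) : ℝ) ≤ (d s(u, v) : ℝ) + (d s(v, w) : ℝ)
  sum_le : ∑ e ∈ G.edgeFinset, (d e : ℝ) + ∑ e ∈ Gᶜ.edgeFinset, (1 - (d e : ℝ)) ≤ β * (opt G : ℝ)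

/-- The rounding function for positive edges, with `a = 0.19` and `b = 0.5095`. -/
noncomputable def fPlus (x : ℝ) : ℝ :=
  if x < 0.19 then 0 else if x ≤ 0.5095 then ((x - 0.19) / (0.5095 - 0.19)) ^ 2 else 1

/-- The rounding function for negative edges. -/
def fMinus (x : ℝ) : ℝ := x

open scoped Classical in
/-- `p_{uv} = f(d_{uv})`, where `f` depends on the sign of the edge `uv`. -/
noncomputable def rejectProb {V : Type*} (G : SimpleGraph V) (d : Sym2 V → unitInterval)
    (u v : V) : ℝ :=
  if G.Adj u v then fPlus (d s(u, v)) else fMinus (d s(u, v))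

/-- The rank `π_u ∈ {1, …, n}`. -/
def rank {V : Type*} [Fintype V] (π : V ≃ Fin (Fintype.card V)) (u : V) : ℕ :=
  (π u : ℕ) + 1

open scoped Classical in
/-- `RankBelow G c ε π v u` says `π_v < τ_u`, where `τ_u = (c / ε) * (n log n) / deg⁺(u)`.
It is written without the division, so that `τ_u = ∞` when `deg⁺(u) = 0` and `n ≥ 2`. -/
def RankBelow {V : Type*} [Fintype V] (G : SimpleGraph V) (c ε : ℝ)
    (π : V ≃ Fin (Fintype.card V)) (v u : V) : Prop :=
  (rank π v : ℝ) * (G.degree u : ℝ) < c / ε * (Fintype.card V * Real.log (Fintype.card V))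

open scoped Classical in
/-- The set of interesting vertices: those `u` with `π_u < τ_u`. -/
noncomputable def interesting {V : Type*} [Fintype V] (G : SimpleGraph V) (c ε : ℝ)
    (π : V ≃ Fin (Fintype.card V)) : Finset V :=
  Finset.univ.filter fun u => RankBelow G c ε π u u

open scoped Classical in
/-- The pivot loop on the set `U` of unclustered vertices. As long as `U` is non-empty, its vertex
`u` of smallest rank becomes a pivot, and the cluster of `u` consists of `u` and all `v ∈ U` with
`join u v`. The result lists the pivots, in the order of `π`, together with their clusters. -/
noncomputable def pivotClusters {V : Type*} [Fintype V] (π : V ≃ Fin (Fintype.card V))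
    (join : V → V → Prop) (U : Finset V) : List (V × Finset V) :=
  if h : U.Nonempty then
    let u : V := π.symm ((U.image π).min' (h.image π))
    let S : Finset V := insert u (U.filter fun v => join u v)
    (u, S) :: pivotClusters π join (U \ S)
  else []
termination_by U.card
decreasing_by
  apply Finset.card_lt_card
  rw [Finset.ssubset_iff_of_subset Finset.sdiff_subset]
  refine ⟨π.symm ((U.image π).min' (h.image π)), ?_, by simp⟩
  obtain ⟨v, hv, hv'⟩ := Finset.mem_image.1 ((U.image π).min'_mem (h.image π))
  rw [← hv']
  simpa using hv

open scoped Classical in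
/-- The pivot of the cluster that `u` ends up in, if any. An interesting vertex is in exactly one
cluster made by the pivot loop on the interesting vertices. An uninteresting vertex `u` joins
the first pivot `v`, in the order of `π`, such that `join v u` and `π_v < τ_u`. -/
noncomputable def pivotOf {V : Type*} [Fintype V] (G : SimpleGraph V) (c ε : ℝ)
    (π : V ≃ Fin (Fintype.card V)) (join : V → V → Prop) (u : V) : Option V :=
  let L := pivotClusters π join (interesting G c ε π)
  if u ∈ interesting G c ε π then
    (L.find? fun q => decide (u ∈ q.2)).map Prod.fst
  else
    (L.find? fun q => decide (join q.1 u ∧ RankBelow G c ε π q.1 u)).map Prod.fst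

/-- The final clustering of a truncated pivot algorithm: the pivot clusters, and a singleton
cluster for each vertex that is in none of them. -/
noncomputable def truncatedClustering {V : Type*} [Fintype V] (G : SimpleGraph V) (c ε : ℝ)
    (π : V ≃ Fin (Fintype.card V)) (join : V → V → Prop) : Setoid V :=
  Setoid.ker fun u => (pivotOf G c ε π join u).getD u

/-- `TruncatedPivot`: a vertex joins a pivot when it is a positive neighbour of it. -/
noncomputable def truncatedPivot {V : Type*} [Fintype V] (G : SimpleGraph V) (c ε : ℝ)
    (π : V ≃ Fin (Fintype.card V)) : Setoid V :=
  truncatedClustering G c ε π G.Adj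

/-- `TruncatedPivotWithPred`, run with the coin flips `B`: the vertex `v` joins the pivot `u` when
`B u v = true`. Each ordered pair `(u, v)` is tested at most once in a run. -/
noncomputable def truncatedPivotWithPred {V : Type*} [Fintype V] (G : SimpleGraph V) (c ε : ℝ)
    (π : V ≃ Fin (Fintype.card V)) (B : V → V → Bool) : Setoid V :=
  truncatedClustering G c ε π fun u v => B u v = true

open scoped Classical in
/-- The output of the offline algorithm: the cheaper one of the two clusterings, which use the same
permutation. -/
noncomputable def offline {V : Type*} [Fintype V] (G : SimpleGraph V) (c ε : ℝ)
    (π : V ≃ Fin (Fintype.card V)) (B : V → V → Bool) : Setoid V :=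
  if cost G (truncatedPivot G c ε π) ≤ cost G (truncatedPivotWithPred G c ε π B) then
    truncatedPivot G c ε π
  else
    truncatedPivotWithPred G c ε π B

/-- The probability of the coin flips `B`: the coins are independent, and `B u v = true` has
probability `1 - p_{uv}`. -/
noncomputable def coinProb {V : Type*} [Fintype V] (G : SimpleGraph V) (d : Sym2 V → unitInterval)
    (B : V → V → Bool) : ℝ :=
  ∏ u : V, ∏ v : V, if B u v = true then 1 - rejectProb G d u v else rejectProb G d u v

open scoped Classical in
/-- The expected cost of the output of the offline algorithm, over a uniformly random permutation
`π` and independent coin flips `B`. -/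
noncomputable def expectedCost {V : Type*} [Fintype V] (G : SimpleGraph V) (c ε : ℝ)
    (d : Sym2 V → unitInterval) : ℝ :=
  (∑ π : V ≃ Fin (Fintype.card V), ∑ B : V → V → Bool,
    coinProb G d B * (cost G (offline G c ε π B) : ℝ)) / ((Fintype.card V).factorial : ℝ)

end CorrClust

namespace CorrClust

/-! ### The rounding functions and the triangle inequalities for the ratio `2.06` -/

/-! Both algorithms are one process, run with acceptance probabilities `q`: positions of `π` are
processed in order, an unclustered vertex whose turn comes becomes a pivot, and each other
unclustered vertex joins it by a coin. At time `t` the vertices with `(t+1) * deg ≥ (c/ε) n log n`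
retire: no later pivot can take them, so they end as singletons. `TruncatedPivot` is the case of 0/1
coins. The interesting and the uninteresting vertices, which the algorithm treats in two phases, are
treated here together.

Without retirement the usual pivot analysis applies. In each step the vertex drawn is uniform among
those not yet drawn, so it suffices that for every triangle the expected cost of the three possible
pivot choices is at most `α` times the expected weight `lpWeight` removed. For the predictor this
holds with `α = 2.06`, by the inequalities for the four sign patterns. For plain pivot it holds with
`α = 3`, where the weights are the 0/1 distances of an optimal clustering. All of this is collected
in `IsRounding`.

Retirement cuts positive edges too early. A cut edge costs `1 ≤ α * lpWeight + q`, so the excess at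
a retiring `u` is its `mass`, the sum of `q u v` over unclustered positive neighbours `v`. If the
mass is at most `δ * deg u`, the excess is a small part of the `deg u` disagreements that the
singleton `u` really causes, and it is absorbed into the left side, which becomes `(1 - 2δ) * cost`.
If the mass is larger, every earlier step took `u` with probability at least `δ * deg u / n`,
because masses only decrease in time. So `u` survives until retirement with probability at most
`exp(δ - δ (c/ε) log n)`. Summation over times and vertices gives `IsRounding.expect_cost_le`.

The choice `δ = ε/20` gives the bound for nonzero optimum. For zero optimum only the tail term
remains, and `δ = 1/4` is used. The lower bound holds pointwise. -/

theorem fPlus_cases (x : ℝ) : (x < 0.19 ∧ fPlus x = 0) ∨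
    (∃ r, 0 ≤ r ∧ r ≤ 1 ∧ x = 0.19 + 0.3195 * r ∧ fPlus x = r ^ 2) ∨
    (0.5095 < x ∧ fPlus x = 1) := by
  unfold fPlus
  split_ifs with h1 h2
  · exact Or.inl ⟨h1, rfl⟩
  · refine Or.inr (Or.inl ⟨(x - 0.19) / (0.5095 - 0.19), ?_, ?_, ?_, rfl⟩)
    · exact div_nonneg (by linarith) (by norm_num)
    · rw [div_le_one (by norm_num)]; linarith
    · norm_num; ring
  · exact Or.inr (Or.inr ⟨not_le.1 h2, rfl⟩)

theorem fPlus_nonneg (x : ℝ) : 0 ≤ fPlus x := by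
  rcases fPlus_cases x with ⟨-, h⟩ | ⟨r, -, -, -, h⟩ | ⟨-, h⟩ <;> rw [h] <;> positivity

theorem fPlus_le_one (x : ℝ) : fPlus x ≤ 1 := by
  rcases fPlus_cases x with ⟨-, h⟩ | ⟨r, h0, h1, -, h⟩ | ⟨-, h⟩ <;> rw [h]
  · norm_num
  · nlinarith

/-- A single rejected positive edge is paid by its own weight. This settles pairs containing the
pivot and, through `fPlus_le_mul_add`, edges cut by retirement. -/
theorem fPlus_le_mul {x : ℝ} (hx : 0 ≤ x) : fPlus x ≤ 2.06 * x := by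
  rcases fPlus_cases x with ⟨-, h⟩ | ⟨r, h0, h1, h2, h⟩ | ⟨h1, h⟩ <;> rw [h]
  · linarith
  · subst h2; nlinarith
  · linarith

theorem fPlus_le_mul_add {x : ℝ} (hx : 0 ≤ x) : 1 ≤ 2.06 * x + (1 - fPlus x) := by
  linarith [fPlus_le_mul hx]

/-- A concave quadratic that is nonnegative at both ends of an interval is nonnegative on it. -/
theorem quadratic_nonneg_of_endpoints {A B C u v t : ℝ} (hA : A ≤ 0) (hu : u ≤ t) (hv : t ≤ v)
    (h1 : 0 ≤ A * u ^ 2 + B * u + C) (h2 : 0 ≤ A * v ^ 2 + B * v + C) :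
    0 ≤ A * t ^ 2 + B * t + C := by
  rcases eq_or_lt_of_le (hu.trans hv) with h | h
  · obtain rfl : t = u := by linarith
    exact h1
  · have key : (v - u) * (A * t ^ 2 + B * t + C) = (v - t) * (A * u ^ 2 + B * u + C) +
        (t - u) * (A * v ^ 2 + B * v + C) + -A * ((v - t) * (t - u) * (v - u)) := by ring
    have : 0 ≤ (v - u) * (A * t ^ 2 + B * t + C) := by
      rw [key]
      have h3 : 0 ≤ v - t := by linarith
      have h4 : 0 ≤ t - u := by linarith
      have h5 : 0 ≤ v - u := by linarith
      have h6 : 0 ≤ -A := by linarith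
      positivity
    exact nonneg_of_mul_nonneg_right this (by linarith)

/-! #### Three negative edges -/

theorem triangle_neg_neg_neg {x y z : ℝ} (hx : 0 ≤ x) (hx1 : x ≤ 1) (hy : 0 ≤ y) (hy1 : y ≤ 1)
    (hz : 0 ≤ z) (hz1 : z ≤ 1) :
    0 ≤ 2.06 * ((1 - x) * (1 - y * z) + (1 - y) * (1 - x * z) + (1 - z) * (1 - x * y)) -
      ((1 - y) * (1 - z) + (1 - x) * (1 - z) + (1 - x) * (1 - y)) := by
  obtain ⟨X, rfl⟩ : ∃ X, x = 1 - X := ⟨1 - x, by ring⟩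
  obtain ⟨Y, rfl⟩ : ∃ X, y = 1 - X := ⟨1 - y, by ring⟩
  obtain ⟨Z, rfl⟩ : ∃ X, z = 1 - X := ⟨1 - z, by ring⟩
  have hX : 0 ≤ X := by linarith
  have hY : 0 ≤ Y := by linarith
  have hZ : 0 ≤ Z := by linarith
  have hX1 : 0 ≤ 1 - X := by linarith
  have hY1 : 0 ≤ 1 - Y := by linarith
  have hZ1 : 0 ≤ 1 - Z := by linarith
  have h1 : 0 ≤ X * Y := by positivity
  have h2 : 0 ≤ Y * Z := by positivity
  have h3 : 0 ≤ X * Z := by positivity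
  nlinarith [mul_nonneg h1 hZ1, mul_nonneg h2 hX1, mul_nonneg h3 hY1]

/-! #### One positive and two negative edges -/

/-- For fixed `y + z` the expression is affine in `y * z` with slope `hK ≥ 0`, so `y * z` may be
replaced by a lower bound. For `y + z ≥ 2 - x` this is `y + z - 1`, where one of the two equals `1`.
Otherwise `|y - z| ≤ x` gives `y * z ≥ ((y + z)^2 - x^2) / 4`, which is replaced by its tangent at
`y + z = 2 - x`. Both bounds leave an affine function of `y + z`, controlled by `hend` and by the
slope bound `hder`. -/
theorem triangle_pos_neg_neg {x y z : ℝ} (hx : 0 ≤ x) (hx1 : x ≤ 1) (hy1 : y ≤ 1)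
    (hz1 : z ≤ 1) (hyz : y ≤ x + z) (hzy : z ≤ x + y) :
    0 ≤ 2.06 * (x * (1 - y * z) + (1 - y) * (1 - fPlus x * z) + (1 - z) * (1 - fPlus x * y)) -
      (y + z - 2 * (y * z) + (1 - fPlus x) * (2 - y - z)) := by
  have hf0 := fPlus_nonneg x
  have hf1 := fPlus_le_one x
  have hfx := fPlus_le_mul hx
  have hend : 0 ≤ 2.06 * (1 - fPlus x + x) - (2 - fPlus x) := by
    rcases fPlus_cases x with ⟨-, h⟩ | ⟨r, h0, h1, h2, h⟩ | ⟨h1, h⟩ <;> rw [h]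
    · linarith
    · subst h2; nlinarith
    · linarith
  have hK : 0 ≤ 2.06 * (2 * fPlus x - x) + 2 := by
    rcases fPlus_cases x with ⟨h1, h⟩ | ⟨r, h0, h1, h2, h⟩ | ⟨h1, h⟩ <;> rw [h]
    · linarith
    · subst h2; nlinarith
    · linarith
  have hder : 0 ≤ -((2 - 2.06) + 1.06 * fPlus x - 3.06 * x - 2.06 * fPlus x * x +
      1.03 * x ^ 2) := by
    rcases fPlus_cases x with ⟨h1, h⟩ | ⟨r, h0, h1, h2, h⟩ | ⟨h1, h⟩ <;> rw [h]
    · nlinarith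
    · subst h2; nlinarith [mul_nonneg h0 (sub_nonneg.2 h1), mul_nonneg (mul_nonneg h0 h0) (sub_nonneg.2 h1)]
    · nlinarith
  set f := fPlus x
  rcases le_total (2 - x) (y + z) with h | h
  · have hp : 0 ≤ (1 - y) * (1 - z) := mul_nonneg (by linarith) (by linarith)
    have h1 := mul_nonneg hK hp
    have h2 := mul_nonneg (show 0 ≤ 2 - (y + z) by linarith) hend
    nlinarith
  · have hp : 0 ≤ y * z - ((1 - x) + (2 - x) / 2 * (y + z - 2 + x)) := by
      nlinarith [mul_nonneg (show 0 ≤ x + y - z by linarith) (show 0 ≤ x + z - y by linarith),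
        sq_nonneg (y + z - (2 - x))]
    have h1 := mul_nonneg hK hp
    have h2 := mul_nonneg hx hend
    have h3 := mul_nonneg (show 0 ≤ 2 - x - (y + z) by linarith) hder
    nlinarith

/-! #### Two positive edges and one negative edge -/

/-- Used twice: for the endpoint `r * s = 0` in `posPosNeg_quadratic`, and for a positive edge so
short that it is never rejected. -/
theorem posPosNeg_lower {m : ℝ} (h0 : 0 ≤ m) :
    0 ≤ 1.06 - (0.38 + 0.3195 * m) * (2 - 1.6086 * m ^ 2) := by
  nlinarith [mul_nonneg h0 (sq_nonneg (m - 0.4)), sq_nonneg (m - 0.4), sq_nonneg (m - 0.5)]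

/-- The endpoint `s = 1` of `posPosNeg_quadratic`. The certificate expands the cubic in the
Bernstein basis of `[0, 0.95]`. -/
theorem posPosNeg_side {r : ℝ} (h0 : 0 ≤ r) (h1 : r ≤ 0.95) :
    0 ≤ 1.06 - 3.06 * r ^ 2 - (0.6995 + 0.3195 * r) *
      (2 - 1.6086 * (r ^ 2 + 1) + 0.65817 * (r * (r + 1)) - 2.06 * r ^ 2) := by
  have hB : 0 ≤ 0.95 - r := by linarith
  have k0 : 0 ≤ r ^ 3 := by positivity
  have k1 : 0 ≤ r ^ 2 * (0.95 - r) := by positivity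
  have k2 : 0 ≤ r * (0.95 - r) ^ 2 := by positivity
  have k3 : 0 ≤ (0.95 - r) ^ 3 := by positivity
  nlinarith only [k0, k1, k2, k3]

/-- The endpoint `r = s` of `posPosNeg_quadratic`. The quintic is certified in the Bernstein bases
of the two halves obtained by cutting the range at `0.5`. -/
theorem posPosNeg_diag {r : ℝ} (h0 : 0 ≤ r) (h1 : 0.38 + 0.639 * r ≤ 1) :
    0 ≤ 1.06 - 3.06 * r ^ 4 - (0.38 + 0.639 * r) *
      (2 - 3.2172 * r ^ 2 + 1.31634 * r ^ 3 - 2.06 * r ^ 4) := by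
  rcases le_total r 0.5 with h | h
  · have hB : 0 ≤ 0.5 - r := by linarith
    have k0 : 0 ≤ r ^ 5 := by positivity
    have k1 : 0 ≤ r ^ 4 * (0.5 - r) := by positivity
    have k2 : 0 ≤ r ^ 3 * (0.5 - r) ^ 2 := by positivity
    have k3 : 0 ≤ r ^ 2 * (0.5 - r) ^ 3 := by positivity
    have k4 : 0 ≤ r * (0.5 - r) ^ 4 := by positivity
    have k5 : 0 ≤ (0.5 - r) ^ 5 := by positivity
    nlinarith only [k0, k1, k2, k3, k4, k5]
  · have hA : 0 ≤ r - 0.5 := by linarith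
    have hB : 0 ≤ 0.62 - 0.639 * r := by linarith
    have k0 : 0 ≤ (r - 0.5) ^ 5 := by positivity
    have k1 : 0 ≤ (r - 0.5) ^ 4 * (0.62 - 0.639 * r) := by positivity
    have k2 : 0 ≤ (r - 0.5) ^ 3 * (0.62 - 0.639 * r) ^ 2 := by positivity
    have k3 : 0 ≤ (r - 0.5) ^ 2 * (0.62 - 0.639 * r) ^ 3 := by positivity
    have k4 : 0 ≤ (r - 0.5) * (0.62 - 0.639 * r) ^ 4 := by positivity
    have k5 : 0 ≤ (0.62 - 0.639 * r) ^ 5 := by positivity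
    nlinarith only [k0, k1, k2, k3, k4, k5]

/-- This is the case `z = x + y` with `x = 0.19 + 0.3195 r`, `y = 0.19 + 0.3195 s`. With `m = r + s`
fixed it is a concave quadratic in `q = r * s`, so only the ends of the range `max(0, m - 1) ≤ q ≤
(m/2)^2` matter: a zero variable, a variable equal to `1`, or equal variables. -/
theorem posPosNeg_quadratic {r s : ℝ} (hr : 0 ≤ r) (hr1 : r ≤ 1) (hs : 0 ≤ s) (hs1 : s ≤ 1)
    (h : 0.38 + 0.3195 * (r + s) ≤ 1) :
    0 ≤ 1.06 - 3.06 * (r * s) ^ 2 - (0.38 + 0.3195 * (r + s)) *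
      (2 - 1.6086 * ((r + s) ^ 2 - 2 * (r * s)) + 0.65817 * (r * s) * (r + s) -
        2.06 * (r * s) ^ 2) := by
  obtain ⟨m, hm⟩ : ∃ m, m = r + s := ⟨_, rfl⟩
  obtain ⟨q, hq⟩ : ∃ q, q = r * s := ⟨_, rfl⟩
  have hm0 : 0 ≤ m := by rw [hm]; positivity
  have hq0 : 0 ≤ q := by rw [hq]; positivity
  have hq1 : m - 1 ≤ q := by rw [hm, hq]; nlinarith
  have hq2 : q ≤ (m / 2) ^ 2 := by rw [hm, hq]; nlinarith [sq_nonneg (r - s)]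
  rw [← hm, ← hq]
  rw [← hm] at h
  have hA : -3.06 + 2.06 * (0.38 + 0.3195 * m) ≤ 0 := by linarith
  have hup := posPosNeg_diag (r := m / 2) (by positivity) (by linarith)
  have main : 0 ≤ (-3.06 + 2.06 * (0.38 + 0.3195 * m)) * q ^ 2 +
      (-((0.38 + 0.3195 * m) * (3.2172 + 0.65817 * m))) * q +
      (1.06 - (0.38 + 0.3195 * m) * (2 - 1.6086 * m ^ 2)) := by
    rcases le_total m 1 with h1 | h1
    · refine quadratic_nonneg_of_endpoints hA hq0 hq2 ?_ ?_
      · have := posPosNeg_lower hm0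
        linarith
      · linarith
    · refine quadratic_nonneg_of_endpoints hA hq1 hq2 ?_ ?_
      · have := posPosNeg_side (r := m - 1) (by linarith) (by linarith)
        linarith
      · linarith
  linarith

/-- The case `z = 1 ≤ x + y`. It forces `r` and `s` close to `1`, so the estimate is made in the
small quantities `S` and `p`, the sum and product of the deviations from `1`; `0.04957 = 2.06 *
0.5095 - 1`. -/
theorem posPosNeg_corner {r s : ℝ} (hr1 : r ≤ 1) (hs1 : s ≤ 1)
    (hr : 0 ≤ r) (hs : 0 ≤ s) (h : 1 ≤ 0.38 + 0.3195 * (r + s)) :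
    0 ≤ (1 - s ^ 2) * (2.06 * (0.19 + 0.3195 * r) - 1) +
      (1 - r ^ 2) * (2.06 * (0.19 + 0.3195 * s) - 1) - (1 - r ^ 2) * (1 - s ^ 2) := by
  obtain ⟨S, hS⟩ : ∃ S, S = (1 - r) + (1 - s) := ⟨_, rfl⟩
  obtain ⟨p, hp⟩ : ∃ p, p = (1 - r) * (1 - s) := ⟨_, rfl⟩
  have hS0 : 0 ≤ S := by linarith
  have hS1 : S ≤ 0.05948 := by norm_num at h ⊢; linarith
  have hp0 : 0 ≤ p := by rw [hp]; exact mul_nonneg (by linarith) (by linarith)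
  have hp1 : 4 * p ≤ S ^ 2 := by rw [hp, hS]; nlinarith [sq_nonneg (r - s)]
  have hp2 : 4 * p ≤ 0.05948 * S := by nlinarith
  have hp3 : 4 * p ≤ 0.0036 := by nlinarith
  have key : 0 ≤ 0.04957 * (2 * S - S ^ 2 + 2 * p) -
      p * (0.65817 * (4 - S) + 4 - 2 * S + p) := by
    nlinarith [mul_nonneg hp0 hS0, mul_nonneg hS0 (sub_nonneg.2 hS1)]
  subst hS hp
  linarith

/-- The inequality for two positive edges `x`, `y` and a negative edge `z`. -/
theorem triangle_pos_pos_neg {x y z : ℝ} (hx : 0 ≤ x) (hy : 0 ≤ y)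
    (hz1 : z ≤ 1) (hzxy : z ≤ x + y) :
    0 ≤ 2.06 * (x * (1 - fPlus y * z) + y * (1 - fPlus x * z) +
        (1 - z) * (1 - fPlus x * fPlus y)) -
      (fPlus x + fPlus y + 2 * z - 2 * (fPlus y * z) - 2 * (fPlus x * z) +
        (1 - fPlus x) * (1 - fPlus y)) := by
  wlog hxy : x ≤ y generalizing x y
  · have := this hy hx (by linarith) (by linarith)
    linarith
  have hf0 := fPlus_nonneg x
  have hf1 := fPlus_le_one x
  have hg0 := fPlus_nonneg y
  have hg1 := fPlus_le_one y
  have hfx := fPlus_le_mul hx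
  have hgy := fPlus_le_mul hy
  -- The expression is affine in `z` with slope minus this quantity, so the worst case is `z =
  -- min(1, x + y)`.
  have hN : 0 ≤ 2.06 * (x * fPlus y + y * fPlus x + 1 - fPlus x * fPlus y) + 2 -
      2 * fPlus x - 2 * fPlus y := by
    nlinarith [mul_nonneg hg0 (sub_nonneg.2 hfx), mul_nonneg hf0 (sub_nonneg.2 hgy),
      mul_nonneg (sub_nonneg.2 hf1) (sub_nonneg.2 hg1), mul_le_one₀ hf1 hg0 hg1]
  have hz1' := mul_nonneg (sub_nonneg.2 hz1) hN
  have hzxy' := mul_nonneg (sub_nonneg.2 hzxy) hN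
  rcases fPlus_cases y with ⟨h1, hg⟩ | ⟨s, hs0, hs1, h2, hg⟩ | ⟨h1, hg⟩
  · rcases fPlus_cases x with ⟨h2, hf⟩ | ⟨r, hr0, hr1, h2, hf⟩ | ⟨h2, hf⟩
    · generalize fPlus x = f at *
      generalize fPlus y = g at *
      subst hf hg
      linarith
    · linarith
    · linarith
  · rcases fPlus_cases x with ⟨h3, hf⟩ | ⟨r, hr0, hr1, h3, hf⟩ | ⟨h3, hf⟩
    · generalize fPlus x = f at *
      generalize fPlus y = g at *
      subst hf hg
      -- At `x = 0.19` the inequality with `z = x + y` is `posPosNeg_lower`; `h5` and `h6` control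
      -- the change when `x` decreases from there.
      have h4 := posPosNeg_lower hs0
      have h5 : 0 ≤ 2.06 * (0.19 + x + y) * s ^ 2 + 2 - 2 * s ^ 2 := by
        have : 0 ≤ (0.19 + x + y) * s ^ 2 := by positivity
        nlinarith
      have h6 := mul_nonneg (show 0 ≤ 0.19 - x by linarith) h5
      subst h2
      linarith
    · rcases le_total (x + y) 1 with h | h
      · have h4 := posPosNeg_quadratic hr0 hr1 hs0 hs1 (by linarith)
        generalize fPlus x = f at *
        generalize fPlus y = g at *
        subst hf hg h2 h3
        linarith
      · have h4 := posPosNeg_corner hr1 hs1 hr0 hs0 (by linarith)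
        generalize fPlus x = f at *
        generalize fPlus y = g at *
        subst hf hg h2 h3
        linarith
    · linarith
  · generalize fPlus y = g at *
    subst hg
    have h2 := mul_nonneg (sub_nonneg.2 hf1) (show 0 ≤ 2.06 * y - 1 by linarith)
    linarith

/-! #### Three positive edges -/

theorem posPosPos_equal {s : ℝ} (h0 : 0 ≤ s) (h1 : s ≤ 1) :
    0 ≤ 0.7828 + 1.31634 * s - 4 * s ^ 2 + 2 * s ^ 4 := by
  nlinarith [sq_nonneg (s ^ 2 - 0.86), sq_nonneg (s - 0.93), mul_nonneg h0 (sub_nonneg.2 h1)]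

/-- Here the shortest edge is never rejected, and only `x ≥ z - y` matters. After substituting it,
the bound is compared with the chord in `t` between `t = s` and `t = 1`; the difference is the
nonnegative term `h8`. -/
theorem posPosPos_short {x s t : ℝ} (hs : 0 ≤ s) (hst : s ≤ t) (ht : t ≤ 1)
    (hx : 0.3195 * (t - s) ≤ x) :
    0 ≤ 2.06 * (0.38 + 0.3195 * (s + t)) + 2.06 * x * (1 - s ^ 2 * t ^ 2) -
      2 * (s ^ 2 + t ^ 2 - s ^ 2 * t ^ 2) := by
  have h1 : 0 ≤ 1 - s ^ 2 * t ^ 2 := by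
    have : s * t ≤ 1 := by nlinarith
    nlinarith [mul_nonneg hs (hs.trans hst)]
  have h2 := mul_nonneg (sub_nonneg.2 hx) h1
  suffices 0 ≤ 0.7828 + 1.31634 * t - 0.65817 * (t - s) * s ^ 2 * t ^ 2 -
      2 * (s ^ 2 + t ^ 2 - s ^ 2 * t ^ 2) by linarith
  rcases eq_or_lt_of_le (hst.trans ht) with h | h
  · obtain rfl : t = 1 := by linarith
    subst h
    norm_num
  · have hG1 : 0 ≤ 0.7828 + 1.31634 - 0.65817 * (1 - s) * s ^ 2 - 2 := by
      nlinarith [mul_nonneg (sq_nonneg (s - 2 / 3)) (show 0 ≤ s + 1 / 3 by linarith)]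
    have hGs := posPosPos_equal hs (hst.trans ht)
    have h3 : 0 ≤ 1 - t := by linarith
    have h4 : 0 ≤ t - s := by linarith
    have h5 : 0 ≤ 1 - s := by linarith
    have h6 : 0 ≤ 1 - s ^ 2 := by nlinarith
    have h7 : 0 ≤ t := by linarith
    have h8 : 0 ≤ (1 - t) * (t - s) * (1 - s) *
        (0.65817 * s ^ 2 * (1 + t) + 2 * (1 - s ^ 2)) := by positivity
    refine nonneg_of_mul_nonneg_right (?_ : 0 ≤ (1 - s) * _) (by linarith)
    linarith [mul_nonneg h3 hGs, mul_nonneg h4 hG1]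

/-- The two longer edges are equal. As a function of `r` this is a quadratic; if it is concave, the
ends `r = 0` and `r = t` suffice, and otherwise all its coefficients are nonnegative. -/
theorem posPosPos_two_equal {r t : ℝ} (hr : 0 ≤ r) (hrt : r ≤ t) (ht : t ≤ 1) :
    0 ≤ 2.06 * (0.19 + 0.3195 * r) * (1 - t ^ 4) +
      4.12 * (0.19 + 0.3195 * t) * (1 - r ^ 2 * t ^ 2) - 2 * r ^ 2 - 4 * t ^ 2 + 2 * t ^ 4 +
      4 * r ^ 2 * t ^ 2 := by
  have ht0 : 0 ≤ t := hr.trans hrt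
  have ht2 : t ^ 2 ≤ 1 := by nlinarith
  have ht4 : 0 ≤ 1 - t ^ 4 := by nlinarith [sq_nonneg (t ^ 2)]
  have hC := posPosPos_equal ht0 ht
  suffices 0 ≤ (-(4.12 * (0.19 + 0.3195 * t) * t ^ 2) - 2 + 4 * t ^ 2) * r ^ 2 +
      (0.65817 * (1 - t ^ 4)) * r + (0.3914 * (1 - t ^ 4) + 4.12 * (0.19 + 0.3195 * t) -
        4 * t ^ 2 + 2 * t ^ 4) by linarith
  rcases le_total (-(4.12 * (0.19 + 0.3195 * t) * t ^ 2) - 2 + 4 * t ^ 2) 0 with h | h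
  · refine quadratic_nonneg_of_endpoints h hr hrt (by linarith) ?_
    have h1 : 0 ≤ 2.06 * (0.19 + 0.3195 * t) * (1 + t ^ 2) - 2 * t ^ 2 := by
      nlinarith [mul_nonneg ht0 (sub_nonneg.2 ht), mul_nonneg ht0 (mul_nonneg ht0 (sub_nonneg.2 ht))]
    linarith [mul_nonneg (sub_nonneg.2 ht2) h1]
  · have h1 := mul_nonneg h (sq_nonneg r)
    have h2 := mul_nonneg hr ht4
    linarith

/-- With `r + s = m` and `t` fixed, the value is least at the smallest possible `q = r * s`. That is
`0` if `m ≤ t`, covered by `posPosPos_short` at `x = 0.19`, and `t * (m - t)` otherwise, which makes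
a second edge equal to the longest. -/
theorem posPosPos_quadratic {r s t : ℝ} (hr : 0 ≤ r) (hs : 0 ≤ s) (hrt : r ≤ t) (hst : s ≤ t)
    (ht : t ≤ 1) (h : 0.3195 * t ≤ 0.19 + 0.3195 * (r + s)) :
    0 ≤ 2.06 * ((0.19 + 0.3195 * r) * (1 - s ^ 2 * t ^ 2) +
        (0.19 + 0.3195 * s) * (1 - r ^ 2 * t ^ 2) + (0.19 + 0.3195 * t) * (1 - r ^ 2 * s ^ 2)) -
      2 * (r ^ 2 + s ^ 2 + t ^ 2) + 2 * (r ^ 2 * s ^ 2 + s ^ 2 * t ^ 2 + t ^ 2 * r ^ 2) := by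
  obtain ⟨m, hm⟩ : ∃ m, m = r + s := ⟨_, rfl⟩
  obtain ⟨q, hq⟩ : ∃ q, q = r * s := ⟨_, rfl⟩
  have hm0 : 0 ≤ m := by rw [hm]; positivity
  have hq0 : 0 ≤ q := by rw [hq]; positivity
  have hq1 : t * (m - t) ≤ q := by
    rw [hm, hq]; nlinarith [mul_nonneg (sub_nonneg.2 hrt) (sub_nonneg.2 hst)]
  have hmt : m ≤ 2 * t := by linarith
  have ht0 : 0 ≤ t := hr.trans hrt
  have ht2 : 0 ≤ 1 - t ^ 2 := by nlinarith
  suffices main : 0 ≤ 2.06 * (0.57 + 0.3195 * (m + t)) -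
      2.06 * t ^ 2 * (0.19 * (m ^ 2 - 2 * q) + 0.3195 * q * m) -
      2.06 * (0.19 + 0.3195 * t) * q ^ 2 - 2 * (m ^ 2 - 2 * q) - 2 * t ^ 2 + 2 * q ^ 2 +
      2 * (m ^ 2 - 2 * q) * t ^ 2 by
    subst hm hq
    linarith
  have hz : 0.95 ≤ 2 - 2.06 * (0.19 + 0.3195 * t) := by linarith
  rcases le_total m t with h1 | h1
  · have h2 := posPosPos_short (x := 0.19) hm0 h1 ht (by linarith)
    have h3 : 0 ≤ 2.06 * t ^ 2 * (0.38 - 0.3195 * m) + 4 * (1 - t ^ 2) +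
        (2 - 2.06 * (0.19 + 0.3195 * t)) * q := by
      have h4 : 0 ≤ (2 - 2.06 * (0.19 + 0.3195 * t)) * q := mul_nonneg (by linarith) hq0
      have h5 : 0 ≤ t ^ 2 * (0.38 - 0.3195 * m) := mul_nonneg (by positivity) (by linarith)
      linarith
    linarith [mul_nonneg hq0 h3]
  · have h2 := posPosPos_two_equal (r := m - t) (by linarith) (by linarith) ht
    have h6 : 0 ≤ t * (m - t) := mul_nonneg ht0 (by linarith)
    have h3 : 0 ≤ 2.06 * t ^ 2 * (0.38 - 0.3195 * m) + 4 * (1 - t ^ 2) +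
        (2 - 2.06 * (0.19 + 0.3195 * t)) * (q + t * (m - t)) := by
      have h4 : 0 ≤ (2 - 2.06 * (0.19 + 0.3195 * t) - 0.95) * (q + t * (m - t)) :=
        mul_nonneg (by linarith) (by linarith)
      have h5 : 0 ≤ t ^ 2 * (0.38 - 0.3195 * t) := mul_nonneg (by positivity) (by linarith)
      nlinarith [mul_nonneg h6 (sub_nonneg.2 ht)]
    linarith [mul_nonneg (sub_nonneg.2 hq1) h3]

theorem triangle_pos_pos_pos_of_le {x y z : ℝ} (hx : 0 ≤ x) (hxy : x ≤ y) (hyz : y ≤ z)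
    (hzxy : z ≤ x + y) :
    0 ≤ 2.06 * (x * (1 - fPlus y * fPlus z) + y * (1 - fPlus x * fPlus z) +
        z * (1 - fPlus x * fPlus y)) - 2 * (fPlus x + fPlus y + fPlus z) +
      2 * (fPlus x * fPlus y + fPlus y * fPlus z + fPlus z * fPlus x) := by
  have hf0 := fPlus_nonneg x
  have hf1 := fPlus_le_one x
  have hg0 := fPlus_nonneg y
  have hg1 := fPlus_le_one y
  have hhz := fPlus_le_mul (hx.trans (hxy.trans hyz))
  have hfg : 0 ≤ 1 - fPlus x * fPlus y := sub_nonneg.2 (mul_le_one₀ hf1 hg0 hg1)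
  rcases fPlus_cases y with ⟨h2, hg⟩ | ⟨s, hs0, hs1, h2, hg⟩ | ⟨h2, hg⟩
  · have hf : fPlus x = 0 := by
      rcases fPlus_cases x with ⟨h1, hf⟩ | ⟨r, hr0, hr1, h1, hf⟩ | ⟨h1, hf⟩
      · exact hf
      · linarith
      · linarith
    rw [hf, hg]
    linarith
  · rcases fPlus_cases z with ⟨h3, hh⟩ | ⟨t, ht0, ht1, h3, hh⟩ | ⟨h3, hh⟩
    · linarith
    · rcases fPlus_cases x with ⟨h1, hf⟩ | ⟨r, hr0, hr1, h1, hf⟩ | ⟨h1, hf⟩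
      · rw [hf, hg, hh]
        have := posPosPos_short (x := x) (s := s) (t := t) hs0 (by linarith) ht1 (by linarith)
        rw [h2, h3]
        linarith
      · rw [hf, hg, hh]
        have := posPosPos_quadratic hr0 hs0 (t := t) (by linarith) (by linarith) ht1
          (by linarith)
        rw [h1, h2, h3]
        linarith
      · linarith
    -- Past `0.5095` the rejection probability of `z` is constant, so the case reduces to `t = 1`;
    -- the surplus `z - 0.5095` is kept as slack.
    · have h4 := mul_nonneg (show 0 ≤ z - 0.5095 by linarith) hfg
      rcases fPlus_cases x with ⟨h1, hf⟩ | ⟨r, hr0, hr1, h1, hf⟩ | ⟨h1, hf⟩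
      · rw [hf, hg, hh]
        have := posPosPos_short (x := x - (z - 0.5095)) (s := s) (t := 1) hs0 hs1 le_rfl
          (by linarith)
        have h5 : 0 ≤ (z - 0.5095) * (1 - s ^ 2) := mul_nonneg (by linarith) (by nlinarith)
        rw [h2]
        linarith
      · have := posPosPos_quadratic hr0 hs0 (t := 1) hr1 hs1 le_rfl (by linarith)
        rw [hf, hg] at h4
        rw [hf, hg, hh, h1, h2]
        linarith
      · linarith
  · have hh : fPlus z = 1 := by
      rcases fPlus_cases z with ⟨h1, hf⟩ | ⟨r, hr0, hr1, h1, hf⟩ | ⟨h1, hf⟩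
      · linarith
      · linarith
      · exact hf
    rw [hg, hh]
    have := mul_nonneg (sub_nonneg.2 hf1) (show 0 ≤ 2.06 * (y + z) - 2 by linarith)
    linarith

/-- The inequality for three positive edges. -/
theorem triangle_pos_pos_pos {x y z : ℝ} (hx : 0 ≤ x) (hy : 0 ≤ y) (hz : 0 ≤ z)
    (hxyz : x ≤ y + z) (hyxz : y ≤ x + z) (hzxy : z ≤ x + y) :
    0 ≤ 2.06 * (x * (1 - fPlus y * fPlus z) + y * (1 - fPlus x * fPlus z) +
        z * (1 - fPlus x * fPlus y)) - 2 * (fPlus x + fPlus y + fPlus z) +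
      2 * (fPlus x * fPlus y + fPlus y * fPlus z + fPlus z * fPlus x) := by
  rcases le_total x y with h1 | h1 <;> rcases le_total y z with h2 | h2 <;>
    rcases le_total x z with h3 | h3
  · linarith [triangle_pos_pos_pos_of_le hx h1 h2 hzxy]
  · linarith [triangle_pos_pos_pos_of_le hx h1 h2 hzxy]
  · linarith [triangle_pos_pos_pos_of_le hx h3 h2 (by linarith)]
  · linarith [triangle_pos_pos_pos_of_le hz h3 h1 (by linarith)]
  · linarith [triangle_pos_pos_pos_of_le hy h1 h3 (by linarith)]
  · linarith [triangle_pos_pos_pos_of_le hy h2 h3 (by linarith)]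
  · linarith [triangle_pos_pos_pos_of_le hz h2 h1 (by linarith)]
  · linarith [triangle_pos_pos_pos_of_le hz h2 h1 (by linarith)]

open scoped Classical

/-! ### Independent coins and random permutations -/

/-- The probability of the outcome `b` of independent coins with success probabilities `p`. -/
noncomputable def rowProb {V : Type*} [Fintype V] (p : V → ℝ) (b : V → Bool) : ℝ :=
  ∏ v, if b v = true then p v else 1 - p v

/-- The probability of the outcome `B` of independent coins with success probabilities `q`. -/
noncomputable def tableProb {V : Type*} [Fintype V] (q : V → V → ℝ) (B : V → V → Bool) : ℝ :=
  ∏ u, rowProb (q u) (B u)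

theorem rowProb_nonneg {V : Type*} [Fintype V] {p : V → ℝ} (h0 : ∀ v, 0 ≤ p v)
    (h1 : ∀ v, p v ≤ 1) (b : V → Bool) : 0 ≤ rowProb p b :=
  Finset.prod_nonneg fun v _ => by
    split_ifs
    · exact h0 v
    · exact sub_nonneg.2 (h1 v)

theorem tableProb_nonneg {V : Type*} [Fintype V] {q : V → V → ℝ} (h0 : ∀ u v, 0 ≤ q u v)
    (h1 : ∀ u v, q u v ≤ 1) (B : V → V → Bool) : 0 ≤ tableProb q B :=
  Finset.prod_nonneg fun u _ => rowProb_nonneg (h0 u) (h1 u) (B u)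

theorem sum_rowProb_mul_prod {V : Type*} [Fintype V] (p : V → ℝ) (φ : V → Bool → ℝ) :
    ∑ b : V → Bool, rowProb p b * ∏ v, φ v (b v) =
      ∏ v, (p v * φ v true + (1 - p v) * φ v false) := by
  have h : ∀ v, p v * φ v true + (1 - p v) * φ v false =
      ∑ x : Bool, (if x = true then p v else 1 - p v) * φ v x := by
    intro v; simp
  simp_rw [h, Finset.prod_univ_sum, Fintype.piFinset_univ, rowProb, Finset.prod_mul_distrib]

theorem sum_rowProb {V : Type*} [Fintype V] (p : V → ℝ) : ∑ b : V → Bool, rowProb p b = 1 := by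
  simpa using sum_rowProb_mul_prod p (fun _ _ => 1)

theorem sum_tableProb {V : Type*} [Fintype V] (q : V → V → ℝ) :
    ∑ B : V → V → Bool, tableProb q B = 1 := by
  have h := Finset.prod_univ_sum (fun _ : V => (Finset.univ : Finset (V → Bool)))
    (fun u b => rowProb (q u) b)
  simp only [Fintype.piFinset_univ, sum_rowProb, Finset.prod_const_one] at h
  exact h.symm

/-- The indicator that `v` joins the cluster of the pivot `w`, whose coins are `b`. -/
noncomputable def joins {V : Type*} (w : V) (b : V → Bool) (v : V) : ℝ :=
  if v = w ∨ b v = true then 1 else 0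

/-- The probability that `v` joins the cluster of the pivot `w`. -/
noncomputable def joinProb {V : Type*} (q : V → V → ℝ) (w v : V) : ℝ :=
  if v = w then 1 else q w v

theorem sum_rowProb_mul_joins {V : Type*} [Fintype V] (q : V → V → ℝ) (w v : V) :
    ∑ b : V → Bool, rowProb (q w) b * joins w b v = joinProb q w v := by
  have h := sum_rowProb_mul_prod (q w)
    (fun x y => if x = v then (if x = w ∨ y = true then 1 else 0) else 1)
  have e : ∀ b : V → Bool, ∏ x, (if x = v then (if x = w ∨ b x = true then (1 : ℝ) else 0) else 1) =
      joins w b v := fun b => by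
    rw [Finset.prod_ite_eq' Finset.univ v]; simp [joins]
  simp_rw [e] at h
  rw [h, Finset.prod_eq_single v]
  · by_cases hv : v = w <;> simp [joinProb, hv]
  · intro x _ hx; simp [hx]
  · simp

theorem sum_rowProb_mul_joins_mul_joins {V : Type*} [Fintype V] (q : V → V → ℝ) (w : V) {u v : V}
    (huv : u ≠ v) : ∑ b : V → Bool, rowProb (q w) b * (joins w b u * joins w b v) =
      joinProb q w u * joinProb q w v := by
  have h := sum_rowProb_mul_prod (q w)
    (fun x y => if x = u ∨ x = v then (if x = w ∨ y = true then 1 else 0) else 1)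
  have e : ∀ b : V → Bool,
      ∏ x, (if x = u ∨ x = v then (if x = w ∨ b x = true then (1 : ℝ) else 0) else 1) =
      joins w b u * joins w b v := fun b => by
    rw [Finset.prod_eq_mul u v huv]
    · simp [joins]
    · rintro x - ⟨h1, h2⟩; simp [h1, h2]
    · simp
    · simp
  simp_rw [e] at h
  rw [h, Finset.prod_eq_mul u v huv]
  · congr 1
    · by_cases hv : u = w <;> simp [joinProb, hv]
    · by_cases hv : v = w <;> simp [joinProb, hv]
  · rintro x - ⟨h1, h2⟩; simp [h1, h2]
  · simp
  · simp

/-- Exchanging row `w` of the table with an independent fresh row preserves the joint probability.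
This makes the exchange used for resampling measure preserving. -/
theorem tableProb_update {V : Type*} [Fintype V] (q : V → V → ℝ) (w : V) (B : V → V → Bool)
    (b : V → Bool) : tableProb q (Function.update B w b) * rowProb (q w) (B w) =
      tableProb q B * rowProb (q w) b := by
  unfold tableProb
  rw [← Finset.mul_prod_erase _ _ (Finset.mem_univ w),
    ← Finset.mul_prod_erase Finset.univ (fun u => rowProb (q u) (B u)) (Finset.mem_univ w)]
  have : ∏ x ∈ Finset.univ.erase w, rowProb (q x) (Function.update B w b x) =
      ∏ x ∈ Finset.univ.erase w, rowProb (q x) (B x) :=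
    Finset.prod_congr rfl fun x hx => by
      rw [Function.update_of_ne (Finset.ne_of_mem_erase hx)]
  rw [this, Function.update_self]
  ring

/-- A row of coins may be drawn afresh when the rest of the experiment does not depend on it. -/
theorem sum_tableProb_resample {V : Type*} [Fintype V] (q : V → V → ℝ) (w : V)
    (Φ : (V → V → Bool) → (V → Bool) → ℝ)
    (h : ∀ B b b', Φ (Function.update B w b) b' = Φ B b') :
    ∑ B, tableProb q B * Φ B (B w) =
      ∑ B, tableProb q B * ∑ b, rowProb (q w) b * Φ B b := by
  have h1 : ∀ B, tableProb q B * Φ B (B w) =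
      ∑ b, tableProb q B * rowProb (q w) b * Φ B (B w) := fun B => by
    rw [← Finset.sum_mul, ← Finset.mul_sum, sum_rowProb, mul_one]
  simp_rw [h1, Finset.mul_sum]
  rw [← Fintype.sum_prod_type', ← Fintype.sum_prod_type']
  let e : (V → V → Bool) × (V → Bool) → (V → V → Bool) × (V → Bool) :=
    fun x => (Function.update x.1 w x.2, x.1 w)
  have he : Function.Involutive e := fun x => by simp [e]
  refine Fintype.sum_equiv he.toPerm _ _ fun x => ?_
  simp only [Function.Involutive.coe_toPerm, e, h]
  rw [← tableProb_update]
  ring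

/-- The vertex at position `t` of a random permutation is uniformly distributed on the vertices
not occurring before, given the order of the latter. -/
theorem sum_perm_position {V : Type*} [Fintype V] (t : Fin (Fintype.card V))
    (F : (V ≃ Fin (Fintype.card V)) → V → ℝ)
    (hF : ∀ π s, t ≤ s → F (π.trans (Equiv.swap t s)) = F π) :
    ((Fintype.card V : ℝ) - (t : ℕ)) * ∑ π, F π (π.symm t) =
      ∑ π, ∑ w with t ≤ π w, F π w := by
  have h1 : ∀ π : V ≃ Fin (Fintype.card V),
      ∑ w with t ≤ π w, F π w = ∑ s ∈ Finset.Ici t, F π (π.symm s) := fun π => by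
    refine Finset.sum_bij (fun w _ => π w) ?_ ?_ ?_ ?_
    · intro w hw; simpa using hw
    · intro a _ b _ hab; simpa using hab
    · intro s hs; exact ⟨π.symm s, by simpa using hs, by simp⟩
    · intro w _; simp
  -- Swapping positions `t` and `s` is an involution on permutations under which `F` is invariant,
  -- so every position `s ≥ t` contributes equally.
  have h2 : ∀ s ∈ Finset.Ici t, ∑ π : V ≃ Fin (Fintype.card V), F π (π.symm s) =
      ∑ π, F π (π.symm t) := fun s hs => by
    let e : (V ≃ Fin (Fintype.card V)) → (V ≃ Fin (Fintype.card V)) :=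
      fun π => π.trans (Equiv.swap t s)
    have he : Function.Involutive e := fun π => by ext; simp [e]
    refine Fintype.sum_equiv he.toPerm _ _ fun π => ?_
    simp only [Function.Involutive.coe_toPerm, e]
    rw [hF π s (Finset.mem_Ici.1 hs)]
    simp
  simp_rw [h1]
  rw [Finset.sum_comm, Finset.sum_congr rfl h2, Finset.sum_const, Fin.card_Ici, nsmul_eq_mul,
    Nat.cast_sub t.2.le]

/-- The expectation of `F`, multiplied by the number of permutations. -/
noncomputable def expect {V : Type*} [Fintype V] (q : V → V → ℝ)
    (F : (V ≃ Fin (Fintype.card V)) → (V → V → Bool) → ℝ) : ℝ :=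
  ∑ π, ∑ B, tableProb q B * F π B

theorem expect_mono {V : Type*} [Fintype V] {q : V → V → ℝ} (h0 : ∀ u v, 0 ≤ q u v)
    (h1 : ∀ u v, q u v ≤ 1) {F F' : (V ≃ Fin (Fintype.card V)) → (V → V → Bool) → ℝ}
    (h : ∀ π B, F π B ≤ F' π B) : expect q F ≤ expect q F' :=
  Finset.sum_le_sum fun π _ => Finset.sum_le_sum fun B _ =>
    mul_le_mul_of_nonneg_left (h π B) (tableProb_nonneg h0 h1 B)

theorem expect_add {V : Type*} [Fintype V] (q : V → V → ℝ)
    (F F' : (V ≃ Fin (Fintype.card V)) → (V → V → Bool) → ℝ) :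
    expect q (fun π B => F π B + F' π B) = expect q F + expect q F' := by
  simp only [expect, mul_add, Finset.sum_add_distrib]

theorem expect_mul {V : Type*} [Fintype V] (q : V → V → ℝ) (a : ℝ)
    (F : (V ≃ Fin (Fintype.card V)) → (V → V → Bool) → ℝ) :
    expect q (fun π B => a * F π B) = a * expect q F := by
  simp only [expect, Finset.mul_sum]
  refine Finset.sum_congr rfl fun π _ => Finset.sum_congr rfl fun B _ => by ring

theorem expect_sum {V ι : Type*} [Fintype V] (q : V → V → ℝ) (s : Finset ι)
    (F : ι → (V ≃ Fin (Fintype.card V)) → (V → V → Bool) → ℝ) :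
    expect q (fun π B => ∑ i ∈ s, F i π B) = ∑ i ∈ s, expect q (F i) := by
  simp only [expect, Finset.mul_sum]
  exact (Finset.sum_congr rfl fun π _ => Finset.sum_comm).trans Finset.sum_comm

theorem expect_const {V : Type*} [Fintype V] (q : V → V → ℝ) (a : ℝ) :
    expect q (fun _ _ => a) = (Fintype.card V).factorial * a := by
  simp only [expect, ← Finset.sum_mul, sum_tableProb, one_mul, Finset.sum_const, nsmul_eq_mul,
    Finset.card_univ, Fintype.card_equiv (Fintype.equivFin V)]

/-- One step of an adapted process: the state `S` at time `t` does not depend on what comes later,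
so the vertex at position `t` and its coins may be drawn afresh. -/
theorem expect_step {V α : Type*} [Fintype V] (q : V → V → ℝ) (t : Fin (Fintype.card V))
    (S : (V ≃ Fin (Fintype.card V)) → (V → V → Bool) → α)
    (hπ : ∀ π B s, t ≤ s → S (π.trans (Equiv.swap t s)) B = S π B)
    (hB : ∀ π B w b, t ≤ π w → S π (Function.update B w b) = S π B)
    (Φ : α → V → (V → Bool) → ℝ) :
    ((Fintype.card V : ℝ) - (t : ℕ)) *
        expect q (fun π B => Φ (S π B) (π.symm t) (B (π.symm t))) =
      expect q (fun π B => ∑ w with t ≤ π w, ∑ b, rowProb (q w) b * Φ (S π B) w b) := by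
  have h1 : expect q (fun π B => Φ (S π B) (π.symm t) (B (π.symm t))) =
      ∑ π : V ≃ Fin (Fintype.card V), ∑ B, tableProb q B *
        ∑ b, rowProb (q (π.symm t)) b * Φ (S π B) (π.symm t) b := by
    refine Finset.sum_congr rfl fun π _ => ?_
    refine sum_tableProb_resample q (π.symm t) (fun B b => Φ (S π B) (π.symm t) b) ?_
    intro B b b'
    rw [hB π B _ b (by simp)]
  have h2 := sum_perm_position t (fun π w => ∑ B, tableProb q B *
        ∑ b, rowProb (q w) b * Φ (S π B) w b) (fun π s hs => by
    funext w
    simp only [hπ π _ s hs])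
  rw [h1, h2]
  refine Finset.sum_congr rfl fun π _ => ?_
  rw [Finset.sum_comm]
  simp only [Finset.mul_sum]

/-! ### Sums over edges as sums over ordered pairs -/

/-- Every edge carries two darts. Sums over ordered pairs are used throughout, hence the factors
`2`. -/
theorem two_mul_sum_edgeFinset {V : Type*} [Fintype V] (G : SimpleGraph V) [Fintype G.edgeSet]
    (f : Sym2 V → ℝ) : 2 * ∑ e ∈ G.edgeFinset, f e = ∑ u, ∑ v, if G.Adj u v then f s(u, v) else 0 := by
  have h1 : ∑ d : G.Dart, f d.edge = 2 * ∑ e ∈ G.edgeFinset, f e := by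
    rw [← Finset.sum_fiberwise_of_maps_to (t := G.edgeFinset) (g := fun d : G.Dart => d.edge)
      (fun d _ => by simp), Finset.mul_sum]
    refine Finset.sum_congr rfl fun e he => ?_
    rw [Finset.sum_congr rfl (g := fun _ => f e) (fun d hd => by rw [(Finset.mem_filter.1 hd).2]),
      Finset.sum_const, G.dart_edge_fiber_card e (by simpa using he)]
    simp
  rw [← h1, ← Finset.sum_product', ← Finset.sum_filter]
  refine Finset.sum_bij (fun d _ => (d.fst, d.snd)) ?_ ?_ ?_ ?_
  · intro d _; simp
  · intro a _ b _ h
    exact SimpleGraph.Dart.ext _ _ (by simpa using h)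
  · rintro ⟨u, v⟩ h
    exact ⟨⟨(u, v), by simpa using h⟩, by simp, rfl⟩
  · intro d _; rfl

theorem within_mk {V : Type*} (C : Setoid V) (u v : V) : Within C s(u, v) ↔ C u v := by
  constructor
  · intro h; exact h u (by simp) v (by simp)
  · intro h a ha b hb
    simp only [Sym2.mem_iff] at ha hb
    rcases ha with rfl | rfl <;> rcases hb with rfl | rfl
    · exact C.refl _
    · exact h
    · exact C.symm h
    · exact C.refl _

/-- The disagreement of the clustering `C` at the pair `u`, `v`. -/
noncomputable def err {V : Type*} (G : SimpleGraph V) (C : Setoid V) (u v : V) : ℝ :=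
  if u = v then 0 else if G.Adj u v then (if C u v then 0 else 1) else if C u v then 1 else 0

theorem err_nonneg {V : Type*} (G : SimpleGraph V) (C : Setoid V) (u v : V) : 0 ≤ err G C u v := by
  unfold err; split_ifs <;> norm_num

theorem err_comm {V : Type*} (G : SimpleGraph V) (C : Setoid V) (u v : V) :
    err G C u v = err G C v u := by
  simp only [err, eq_comm (a := u), G.adj_comm u v, show C u v ↔ C v u from ⟨C.symm, C.symm⟩]

/-- The weight of the pair `u`, `v` in the linear programming relaxation. -/
noncomputable def lpWeight {V : Type*} (G : SimpleGraph V) (x : V → V → ℝ) (u v : V) : ℝ :=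
  if u = v then 0 else if G.Adj u v then x u v else 1 - x u v

theorem two_mul_sum_add_sum {V : Type*} [Fintype V] (G : SimpleGraph V) (x : Sym2 V → ℝ) :
    2 * (∑ e ∈ G.edgeFinset, x e + ∑ e ∈ Gᶜ.edgeFinset, (1 - x e)) =
      ∑ u, ∑ v, lpWeight G (fun u v => x s(u, v)) u v := by
  rw [mul_add, two_mul_sum_edgeFinset, two_mul_sum_edgeFinset, ← Finset.sum_add_distrib]
  refine Finset.sum_congr rfl fun u _ => ?_
  rw [← Finset.sum_add_distrib]
  refine Finset.sum_congr rfl fun v _ => ?_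
  unfold lpWeight
  by_cases h1 : u = v
  · subst h1; simp
  · by_cases h2 : G.Adj u v <;> simp [h1, h2]

theorem two_mul_cost {V : Type*} [Fintype V] (G : SimpleGraph V) (C : Setoid V) :
    2 * (cost G C : ℝ) = ∑ u, ∑ v, err G C u v := by
  have h := two_mul_sum_add_sum G (fun e => if Within C e then 0 else 1)
  have e1 : (cost G C : ℝ) = ∑ e ∈ G.edgeFinset, (if Within C e then (0 : ℝ) else 1) +
      ∑ e ∈ Gᶜ.edgeFinset, (1 - if Within C e then (0 : ℝ) else 1) := by
    simp only [cost, Nat.cast_add, Finset.card_filter, Nat.cast_sum]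
    congr 1 <;> refine Finset.sum_congr rfl fun e _ => ?_ <;> by_cases hw : Within C e <;> simp [hw]
  rw [e1, h]
  refine Finset.sum_congr rfl fun u _ => Finset.sum_congr rfl fun v _ => ?_
  unfold lpWeight err
  simp only [within_mk]
  split_ifs <;> norm_num

/-! ### The pivot process -/

/-- A pivot at position `t` (counted from `0`) can still take `v`; here `M` stands for
`(c / ε) * n log n`. -/
def Alive {V : Type*} [Fintype V] (G : SimpleGraph V) (M : ℝ) (t : ℕ) (v : V) : Prop :=
  ((t : ℝ) + 1) * (G.degree v : ℝ) < M

theorem Alive.mono {V : Type*} [Fintype V] {G : SimpleGraph V} {M : ℝ} {s t : ℕ} {v : V}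
    (h : Alive G M t v) (hst : s ≤ t) : Alive G M s v := by
  refine lt_of_le_of_lt ?_ h
  gcongr

/-- The vertices of `U` that are not retired at time `t`. -/
noncomputable def alive {V : Type*} [Fintype V] (G : SimpleGraph V) (M : ℝ) (t : ℕ)
    (U : Finset V) : Finset V :=
  U.filter (Alive G M t)

/-- The vertices of `W` that remain after `w` has been processed with the coins `b`. -/
noncomputable def afterPivot {V : Type*} (W : Finset V) (w : V) (b : V → Bool) : Finset V :=
  if w ∈ W then W.filter (fun v => ¬ (v = w ∨ b v = true)) else W

theorem afterPivot_subset {V : Type*} (W : Finset V) (w : V) (b : V → Bool) :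
    afterPivot W w b ⊆ W := by
  unfold afterPivot; split_ifs
  · exact Finset.filter_subset _ _
  · exact subset_rfl

/-- The vertices neither clustered nor retired before time `t`. -/
noncomputable def unclustered {V : Type*} [Fintype V] (G : SimpleGraph V) (M : ℝ)
    (π : V ≃ Fin (Fintype.card V)) (B : V → V → Bool) : ℕ → Finset V
  | 0 => Finset.univ
  | t + 1 =>
    if h : t < Fintype.card V then
      afterPivot (alive G M t (unclustered G M π B t)) (π.symm ⟨t, h⟩) (B (π.symm ⟨t, h⟩))
    else alive G M t (unclustered G M π B t)

section Unclustered

variable {V : Type*} [Fintype V] {G : SimpleGraph V} {M : ℝ} {π : V ≃ Fin (Fintype.card V)}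
  {B : V → V → Bool}

theorem unclustered_succ (t : Fin (Fintype.card V)) :
    unclustered G M π B (t + 1) =
      afterPivot (alive G M t (unclustered G M π B t)) (π.symm t) (B (π.symm t)) := by
  simp [unclustered]

theorem mem_alive {t : ℕ} {U : Finset V} {v : V} : v ∈ alive G M t U ↔ v ∈ U ∧ Alive G M t v := by
  simp [alive]

/-- A vertex cannot outlive its own position: there it is already gone, retires, or becomes a pivot
and takes itself. -/
theorem le_of_mem_unclustered {t : ℕ} {v : V} (h : v ∈ unclustered G M π B t) :
    t ≤ (π v : ℕ) := by
  induction t with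
  | zero => exact Nat.zero_le _
  | succ t ih =>
    rw [unclustered] at h
    split_ifs at h with ht
    · have h2 := ih (mem_alive.1 (afterPivot_subset _ _ _ h)).1
      refine Nat.lt_of_le_of_ne h2 fun h3 => ?_
      have h4 : π.symm ⟨t, ht⟩ = v := by rw [Equiv.symm_apply_eq]; exact Fin.ext h3
      have h5 := afterPivot_subset _ _ _ h
      rw [h4] at h
      simp [afterPivot, h5] at h
    · have h2 := ih (mem_alive.1 h).1
      have := (π v).2
      omega

theorem unclustered_card : unclustered G M π B (Fintype.card V) = ∅ := by
  refine Finset.eq_empty_of_forall_notMem fun v hv => ?_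
  have := le_of_mem_unclustered hv
  have := (π v).2
  omega

/-- The state at time `k` depends only on the first `k` vertices of `π` and their rows of coins.
This lemma and the next are the adaptedness hypotheses of `expect_step`. -/
theorem unclustered_swap {t s : Fin (Fintype.card V)} (hts : t ≤ s) {k : ℕ} (hk : k ≤ t) :
    unclustered G M (π.trans (Equiv.swap t s)) B k = unclustered G M π B k := by
  induction k with
  | zero => rfl
  | succ k ih =>
    have hk' : k < Fintype.card V := by omega
    have h1 : (π.trans (Equiv.swap t s)).symm ⟨k, hk'⟩ = π.symm ⟨k, hk'⟩ := by
      simp only [Equiv.symm_trans_apply, Equiv.symm_swap]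
      rw [Equiv.swap_apply_of_ne_of_ne]
      · rintro rfl; simp at hk
      · rintro rfl; simp [Fin.le_def] at hts hk; omega
    simp only [unclustered, hk', dif_pos, h1, ih (Nat.le_of_succ_le hk)]

theorem unclustered_update {w : V} {b : V → Bool} {k : ℕ} (hk : k ≤ (π w : ℕ)) :
    unclustered G M π (Function.update B w b) k = unclustered G M π B k := by
  induction k with
  | zero => rfl
  | succ k ih =>
    have hk' : k < Fintype.card V := by have := (π w).2; omega
    have h1 : π.symm ⟨k, hk'⟩ ≠ w := by
      rintro rfl; simp at hk
    simp only [unclustered, hk', dif_pos, ih (Nat.le_of_succ_le hk), Function.update_of_ne h1]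

end Unclustered

/-! ### The pivot loop on lists -/

theorem pivotClusters_eq_cons {V : Type*} [Fintype V] {π : V ≃ Fin (Fintype.card V)}
    {join : V → V → Prop} {R : Finset V} {w : V} (hw : w ∈ R) (hmin : ∀ v ∈ R, π w ≤ π v) :
    pivotClusters π join R = (w, insert w (R.filter fun v => join w v)) ::
      pivotClusters π join (R \ insert w (R.filter fun v => join w v)) := by
  have hne : R.Nonempty := ⟨w, hw⟩
  have h1 : π.symm ((R.image π).min' (hne.image π)) = w := by
    rw [Equiv.symm_apply_eq]
    refine le_antisymm (Finset.min'_le _ _ (Finset.mem_image_of_mem _ hw)) ?_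
    refine Finset.le_min' _ _ _ fun y hy => ?_
    obtain ⟨v, hv, rfl⟩ := Finset.mem_image.1 hy
    exact hmin v hv
  rw [pivotClusters, dif_pos hne]
  simp only [h1]

theorem fst_mem_of_mem_pivotClusters {V : Type*} [Fintype V] {π : V ≃ Fin (Fintype.card V)}
    {join : V → V → Prop} {R : Finset V} {p : V × Finset V} (hp : p ∈ pivotClusters π join R) :
    p.1 ∈ R := by
  induction R using Finset.strongInduction with
  | H R ih =>
    by_cases hne : R.Nonempty
    · obtain ⟨w, hw, hmin⟩ := Finset.exists_min_image R π hne
      rw [pivotClusters_eq_cons hw hmin, List.mem_cons] at hp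
      rcases hp with rfl | hp
      · exact hw
      · refine (Finset.mem_sdiff.1 (ih _ ?_ hp)).1
        refine (Finset.ssubset_iff_of_subset Finset.sdiff_subset).2 ⟨w, hw, by simp⟩
    · rw [pivotClusters, dif_neg hne] at hp
      simp at hp

/-! ### The clustering described by the pivot process -/

/-- The numerator `(c / ε) * n log n` of the thresholds `τ_u`. -/
noncomputable def threshold (V : Type*) [Fintype V] (c ε : ℝ) : ℝ :=
  c / ε * (Fintype.card V * Real.log (Fintype.card V))

section Link

variable {V : Type*} [Fintype V] {G : SimpleGraph V} {c ε : ℝ} {π : V ≃ Fin (Fintype.card V)}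
  {B : V → V → Bool}

theorem rankBelow_iff {v u : V} :
    RankBelow G c ε π v u ↔ Alive G (threshold V c ε) (π v) u := by
  unfold RankBelow Alive rank threshold
  push_cast
  exact Iff.rfl

theorem mem_interesting {u : V} :
    u ∈ interesting G c ε π ↔ Alive G (threshold V c ε) (π u) u := by
  simp [interesting, rankBelow_iff]

/-- The interesting vertices that are unclustered at time `t`. -/
noncomputable def remaining (G : SimpleGraph V) (c ε : ℝ) (π : V ≃ Fin (Fintype.card V))
    (B : V → V → Bool) (t : ℕ) : Finset V :=
  (unclustered G (threshold V c ε) π B t).filter (· ∈ interesting G c ε π)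

/-- The part of the pivot loop that takes place from time `t` on. -/
noncomputable def pivotsFrom (G : SimpleGraph V) (c ε : ℝ) (π : V ≃ Fin (Fintype.card V))
    (B : V → V → Bool) (t : ℕ) : List (V × Finset V) :=
  pivotClusters π (fun u v => B u v = true) (remaining G c ε π B t)

/-- The first pivot from time `t` on whose cluster `u` joins. -/
noncomputable def pivotFrom (G : SimpleGraph V) (c ε : ℝ) (π : V ≃ Fin (Fintype.card V))
    (B : V → V → Bool) (t : ℕ) (u : V) : Option V :=
  if u ∈ interesting G c ε π then
    ((pivotsFrom G c ε π B t).find? fun q => decide (u ∈ q.2)).map Prod.fst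
  else
    ((pivotsFrom G c ε π B t).find?
      fun q => decide (B q.1 u = true ∧ RankBelow G c ε π q.1 u)).map Prod.fst

theorem pivotFrom_zero (u : V) :
    pivotFrom G c ε π B 0 u = pivotOf G c ε π (fun u v => B u v = true) u := by
  have : remaining G c ε π B 0 = interesting G c ε π := by
    ext v; simp [remaining, unclustered]
  unfold pivotFrom pivotOf pivotsFrom
  rw [this]
  dsimp only
  congr!

theorem fst_mem_of_mem_pivotsFrom {t : ℕ} {p : V × Finset V} (hp : p ∈ pivotsFrom G c ε π B t) :
    p.1 ∈ interesting G c ε π ∧ t ≤ (π p.1 : ℕ) := by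
  have := Finset.mem_filter.1 (fst_mem_of_mem_pivotClusters hp)
  exact ⟨this.2, le_of_mem_unclustered this.1⟩

theorem of_pivotFrom_eq_some {t : ℕ} {u w : V} (h : pivotFrom G c ε π B t u = some w) :
    w ∈ interesting G c ε π ∧ t ≤ (π w : ℕ) := by
  unfold pivotFrom at h
  split_ifs at h <;>
  · obtain ⟨p, hp, rfl⟩ := Option.map_eq_some_iff.1 h
    exact fst_mem_of_mem_pivotsFrom (List.mem_of_find?_eq_some hp)

theorem alive_of_mem_interesting {t : ℕ} {u : V} (h : u ∈ interesting G c ε π)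
    (hu : u ∈ unclustered G (threshold V c ε) π B t) : Alive G (threshold V c ε) t u :=
  (mem_interesting.1 h).mono (le_of_mem_unclustered hu)

/-- Thresholds are monotone in time: `u` has position at least `t`, so it is not interesting, and
all pivots from `t` on come too late for it. -/
theorem pivotFrom_of_not_alive {t : ℕ} {u : V} (hu : ¬ Alive G (threshold V c ε) t u)
    (h : u ∈ unclustered G (threshold V c ε) π B t) :
    u ∉ interesting G c ε π ∧ pivotFrom G c ε π B t u = none := by
  have h1 : u ∉ interesting G c ε π := fun h' => hu (alive_of_mem_interesting h' h)
  refine ⟨h1, ?_⟩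
  rw [pivotFrom, if_neg h1, Option.map_eq_none_iff, List.find?_eq_none]
  intro p hp h2
  have h3 := (of_decide_eq_true h2).2
  exact hu ((rankBelow_iff.1 h3).mono (fst_mem_of_mem_pivotsFrom hp).2)

theorem symm_mem_interesting {t : Fin (Fintype.card V)}
    (h : π.symm t ∈ alive G (threshold V c ε) t (unclustered G (threshold V c ε) π B t)) :
    π.symm t ∈ interesting G c ε π := by
  have := (mem_alive.1 h).2
  rw [mem_interesting]
  simpa using this

/-- Interesting vertices never retire while unclustered, so retirement is invisible to the pivot
loop, and one step of the process is exactly one iteration of the loop. -/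
theorem pivotsFrom_of_mem {t : Fin (Fintype.card V)}
    (h : π.symm t ∈ alive G (threshold V c ε) t (unclustered G (threshold V c ε) π B t)) :
    pivotsFrom G c ε π B t = (π.symm t, insert (π.symm t)
      ((remaining G c ε π B t).filter fun v => B (π.symm t) v = true)) ::
        pivotsFrom G c ε π B (t + 1) := by
  have hw : π.symm t ∈ remaining G c ε π B t :=
    Finset.mem_filter.2 ⟨(mem_alive.1 h).1, symm_mem_interesting h⟩
  have key : remaining G c ε π B t \ insert (π.symm t)
      ((remaining G c ε π B t).filter fun v => B (π.symm t) v = true) =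
        remaining G c ε π B (t + 1) := by
    unfold remaining
    rw [unclustered_succ, afterPivot, if_pos h]
    ext v
    simp only [Finset.mem_sdiff, Finset.mem_insert, Finset.mem_filter, mem_alive]
    constructor
    · rintro ⟨⟨h1, h2⟩, h3⟩
      refine ⟨⟨⟨h1, alive_of_mem_interesting h2 h1⟩, ?_⟩, h2⟩
      tauto
    · tauto
  have hmin : ∀ v ∈ remaining G c ε π B t, π (π.symm t) ≤ π v := fun v hv => by
    have := le_of_mem_unclustered (Finset.mem_filter.1 hv).1
    rw [Equiv.apply_symm_apply]
    exact this
  rw [pivotsFrom, pivotClusters_eq_cons hw hmin, pivotsFrom, ← key]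
  congr!

theorem pivotsFrom_of_notMem {t : Fin (Fintype.card V)}
    (h : π.symm t ∉ alive G (threshold V c ε) t (unclustered G (threshold V c ε) π B t)) :
    pivotsFrom G c ε π B t = pivotsFrom G c ε π B (t + 1) := by
  unfold pivotsFrom remaining
  rw [unclustered_succ, afterPivot, if_neg h]
  congr 1
  ext v
  simp only [Finset.mem_filter, mem_alive]
  constructor
  · rintro ⟨h1, h2⟩
    exact ⟨⟨h1, alive_of_mem_interesting h2 h1⟩, h2⟩
  · tauto

theorem pivotFrom_of_joins {t : Fin (Fintype.card V)} {u : V}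
    (h : π.symm t ∈ alive G (threshold V c ε) t (unclustered G (threshold V c ε) π B t))
    (hu : u ∈ alive G (threshold V c ε) t (unclustered G (threshold V c ε) π B t))
    (hj : u = π.symm t ∨ B (π.symm t) u = true) :
    pivotFrom G c ε π B t u = some (π.symm t) := by
  rw [mem_alive] at hu
  unfold pivotFrom
  rw [pivotsFrom_of_mem h]
  split_ifs with h1
  · rw [List.find?_cons_of_pos]
    · rfl
    · simp only [remaining, Finset.mem_insert, Finset.mem_filter, decide_eq_true_eq]
      tauto
  · rw [List.find?_cons_of_pos]
    · rfl
    · rw [decide_eq_true_eq]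
      refine ⟨hj.resolve_left ?_, ?_⟩
      · rintro rfl
        exact h1 (symm_mem_interesting h)
      · rw [rankBelow_iff]
        simpa using hu.2

theorem pivotFrom_succ {t : Fin (Fintype.card V)} {u : V}
    (hu : u ∈ unclustered G (threshold V c ε) π B (t + 1)) :
    pivotFrom G c ε π B t u = pivotFrom G c ε π B (t + 1) u := by
  by_cases h : π.symm t ∈ alive G (threshold V c ε) t (unclustered G (threshold V c ε) π B t)
  · rw [unclustered_succ, afterPivot, if_pos h, Finset.mem_filter] at hu
    unfold pivotFrom
    rw [pivotsFrom_of_mem h]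
    split_ifs with h1
    · rw [List.find?_cons_of_neg]
      simp only [Finset.mem_insert, Finset.mem_filter, decide_eq_true_eq]
      tauto
    · rw [List.find?_cons_of_neg]
      rw [decide_eq_true_eq]
      tauto
  · unfold pivotFrom
    rw [pivotsFrom_of_notMem h]

theorem pivotOf_eq_pivotFrom {t : ℕ} {u : V} (ht : t ≤ Fintype.card V)
    (hu : u ∈ unclustered G (threshold V c ε) π B t) :
    pivotOf G c ε π (fun u v => B u v = true) u = pivotFrom G c ε π B t u := by
  induction t with
  | zero => rw [pivotFrom_zero]
  | succ t ih =>
    have h1 := unclustered_succ (G := G) (M := threshold V c ε) (π := π) (B := B) ⟨t, ht⟩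
    have h2 : u ∈ unclustered G (threshold V c ε) π B t := by
      dsimp only at h1
      rw [h1] at hu
      exact (mem_alive.1 (afterPivot_subset _ _ _ hu)).1
    rw [ih (Nat.le_of_succ_le ht) h2]
    exact pivotFrom_succ (t := ⟨t, ht⟩) hu

/-- A vertex that is retired forms a singleton cluster. -/
theorem truncatedClustering_of_not_alive {t : ℕ} {u v : V} (ht : t ≤ Fintype.card V)
    (h : u ∈ unclustered G (threshold V c ε) π B t) (hu : ¬ Alive G (threshold V c ε) t u)
    (huv : u ≠ v) : ¬ truncatedClustering G c ε π (fun u v => B u v = true) u v := by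
  obtain ⟨h1, h2⟩ := pivotFrom_of_not_alive hu h
  rw [← pivotOf_eq_pivotFrom ht h] at h2
  rw [truncatedClustering, Setoid.ker_def, h2, Option.getD_none]
  rcases h3 : pivotOf G c ε π (fun u v => B u v = true) v with - | w
  · simpa using huv
  · rw [← pivotFrom_zero] at h3
    rintro rfl
    exact h1 (of_pivotFrom_eq_some h3).1

/-- All vertices that join a pivot are in one cluster. -/
theorem truncatedClustering_of_joins {t : Fin (Fintype.card V)} {u v : V}
    (h : π.symm t ∈ alive G (threshold V c ε) t (unclustered G (threshold V c ε) π B t))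
    (hu : u ∈ alive G (threshold V c ε) t (unclustered G (threshold V c ε) π B t))
    (hv : v ∈ alive G (threshold V c ε) t (unclustered G (threshold V c ε) π B t))
    (hju : u = π.symm t ∨ B (π.symm t) u = true) (hjv : v = π.symm t ∨ B (π.symm t) v = true) :
    truncatedClustering G c ε π (fun u v => B u v = true) u v := by
  rw [truncatedClustering, Setoid.ker_def,
    pivotOf_eq_pivotFrom t.2.le (mem_alive.1 hu).1, pivotOf_eq_pivotFrom t.2.le (mem_alive.1 hv).1,
    pivotFrom_of_joins h hu hju, pivotFrom_of_joins h hv hjv]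
  rfl

/-- A vertex that does not join a pivot is not in its cluster. -/
theorem truncatedClustering_of_not_joins {t : Fin (Fintype.card V)} {u v : V}
    (h : π.symm t ∈ alive G (threshold V c ε) t (unclustered G (threshold V c ε) π B t))
    (hu : u ∈ alive G (threshold V c ε) t (unclustered G (threshold V c ε) π B t))
    (hv : v ∈ alive G (threshold V c ε) t (unclustered G (threshold V c ε) π B t))
    (hju : u = π.symm t ∨ B (π.symm t) u = true)
    (hjv : ¬ (v = π.symm t ∨ B (π.symm t) v = true)) :
    ¬ truncatedClustering G c ε π (fun u v => B u v = true) u v := by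
  have hv' : v ∈ unclustered G (threshold V c ε) π B (t + 1) := by
    rw [unclustered_succ, afterPivot, if_pos h, Finset.mem_filter]
    exact ⟨hv, hjv⟩
  rw [truncatedClustering, Setoid.ker_def,
    pivotOf_eq_pivotFrom t.2.le (mem_alive.1 hu).1, pivotOf_eq_pivotFrom t.2 hv',
    pivotFrom_of_joins h hu hju, Option.getD_some]
  rcases h3 : pivotFrom G c ε π B (t + 1) v with - | w
  · intro h4
    exact hjv (Or.inl h4.symm)
  · rintro rfl
    have := (of_pivotFrom_eq_some h3).2
    simp at this

end Link

/-! ### Charging the cost to the steps of the process -/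

/-- The sum of `φ` over the ordered pairs in `A`. -/
def pairSum {V : Type*} (φ : V → V → ℝ) (A : Finset V) : ℝ := ∑ u ∈ A, ∑ v ∈ A, φ u v

/-- The cost at the pair `u`, `v` of a pivot that takes `u` and `v` with weights `s` and `t`. -/
noncomputable def charge {V : Type*} (G : SimpleGraph V) (u v : V) (s t : ℝ) : ℝ :=
  if u = v then 0 else if G.Adj u v then s * (1 - t) + t * (1 - s) else s * t

/-- The cost of the step in which `w` is processed with the coins `b`. -/
noncomputable def pivotCharge {V : Type*} (G : SimpleGraph V) (W : Finset V) (w : V)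
    (b : V → Bool) : ℝ :=
  if w ∈ W then pairSum (fun u v => charge G u v (joins w b u) (joins w b v)) W else 0

/-- The expected number of positive neighbours of `u` in `U` that would take `u` as pivots. -/
noncomputable def mass {V : Type*} (G : SimpleGraph V) (q : V → V → ℝ) (u : V)
    (U : Finset V) : ℝ :=
  ∑ v ∈ U, if G.Adj u v then q u v else 0

/-- The indicator that the mass of `u` in `U` is large. -/
noncomputable def heavy {V : Type*} [Fintype V] (G : SimpleGraph V) (q : V → V → ℝ) (δ : ℝ) (u : V)
    (U : Finset V) : ℝ :=
  if δ * (G.degree u : ℝ) < mass G q u U then 1 else 0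

theorem pairSum_filter {V : Type*} (φ : V → V → ℝ) (A : Finset V) (P : V → Prop)
    [DecidablePred P] : pairSum φ (A.filter P) = pairSum (fun u v => if P u ∧ P v then φ u v else 0) A := by
  unfold pairSum
  rw [Finset.sum_filter]
  refine Finset.sum_congr rfl fun u _ => ?_
  by_cases hu : P u
  · simp [hu, Finset.sum_filter]
  · simp [hu]

theorem pairSum_mono {V : Type*} {φ ψ : V → V → ℝ} {A : Finset V}
    (h : ∀ u ∈ A, ∀ v ∈ A, φ u v ≤ ψ u v) : pairSum φ A ≤ pairSum ψ A :=
  Finset.sum_le_sum fun u hu => Finset.sum_le_sum fun v hv => h u hu v hv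

theorem pairSum_add {V : Type*} (φ ψ : V → V → ℝ) (A : Finset V) :
    pairSum (fun u v => φ u v + ψ u v) A = pairSum φ A + pairSum ψ A := by
  simp only [pairSum, Finset.sum_add_distrib]

theorem pairSum_sub {V : Type*} (φ ψ : V → V → ℝ) (A : Finset V) :
    pairSum (fun u v => φ u v - ψ u v) A = pairSum φ A - pairSum ψ A := by
  simp only [pairSum, Finset.sum_sub_distrib]

theorem pairSum_mul {V : Type*} (a : ℝ) (φ : V → V → ℝ) (A : Finset V) :
    pairSum (fun u v => a * φ u v) A = a * pairSum φ A := by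
  simp only [pairSum, Finset.mul_sum]

theorem mass_mono {V : Type*} {G : SimpleGraph V} {q : V → V → ℝ} (hq : ∀ u v, 0 ≤ q u v) {u : V}
    {U U' : Finset V} (h : U ⊆ U') : mass G q u U ≤ mass G q u U' :=
  Finset.sum_le_sum_of_subset_of_nonneg h fun v _ _ => by
    split_ifs
    · exact hq u v
    · exact le_rfl

theorem mass_le_card {V : Type*} [Fintype V] {G : SimpleGraph V} {q : V → V → ℝ}
    (hq : ∀ u v, q u v ≤ 1) (u : V) (U : Finset V) : mass G q u U ≤ Fintype.card V := by
  calc mass G q u U ≤ ∑ v ∈ U, (1 : ℝ) := Finset.sum_le_sum fun v _ => by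
        split_ifs
        · exact hq u v
        · norm_num
    _ ≤ Fintype.card V := by
        simp only [Finset.sum_const, nsmul_eq_mul, mul_one]
        exact_mod_cast Finset.card_le_univ U

theorem heavy_nonneg {V : Type*} [Fintype V] (G : SimpleGraph V) (q : V → V → ℝ) (δ : ℝ) (u : V)
    (U : Finset V) : 0 ≤ heavy G q δ u U := by
  unfold heavy; split_ifs <;> norm_num

theorem mass_le_add_heavy {V : Type*} [Fintype V] {G : SimpleGraph V} {q : V → V → ℝ}
    (hq : ∀ u v, q u v ≤ 1) {δ : ℝ} (hδ : 0 ≤ δ) (u : V) (U : Finset V) :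
    mass G q u U ≤ δ * G.degree u + Fintype.card V * heavy G q δ u U := by
  unfold heavy
  split_ifs with h
  · have := mass_le_card (G := G) hq u U
    have : 0 ≤ δ * (G.degree u : ℝ) := by positivity
    linarith
  · linarith

/-! ### Telescoping the cost along the process. -/

section Charge

variable {V : Type*} [Fintype V] {G : SimpleGraph V} {c ε : ℝ} {π : V ≃ Fin (Fintype.card V)}
  {B : V → V → Bool}

/-- The pairs that leave are those touched by the new cluster, and their disagreement is already
decided: pairs inside it are together, pairs across its boundary are separated. -/
theorem pairSum_err_pivot (t : Fin (Fintype.card V)) :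
    pairSum (err G (truncatedClustering G c ε π fun u v => B u v = true))
        (alive G (threshold V c ε) t (unclustered G (threshold V c ε) π B t)) -
      pairSum (err G (truncatedClustering G c ε π fun u v => B u v = true))
        (unclustered G (threshold V c ε) π B (t + 1)) ≤
      pivotCharge G (alive G (threshold V c ε) t (unclustered G (threshold V c ε) π B t))
        (π.symm t) (B (π.symm t)) := by
  rw [unclustered_succ, afterPivot, pivotCharge]
  split_ifs with hw
  · rw [pairSum_filter, ← pairSum_sub]
    refine pairSum_mono fun u hu v hv => ?_
    unfold err charge joins
    by_cases huv : u = v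
    · simp [huv]
    by_cases hju : u = π.symm t ∨ B (π.symm t) u = true <;>
      by_cases hjv : v = π.symm t ∨ B (π.symm t) v = true
    · have := truncatedClustering_of_joins hw hu hv hju hjv
      by_cases hadj : G.Adj u v <;> simp [huv, hju, hjv, hadj, this]
    · have := truncatedClustering_of_not_joins hw hu hv hju hjv
      by_cases hadj : G.Adj u v <;> simp [huv, hju, hjv, hadj, this]
    · have := truncatedClustering_of_not_joins hw hv hu hjv hju
      have h2 : ¬ truncatedClustering G c ε π (fun u v => B u v = true) u v :=
        fun h => this (Setoid.symm' _ h)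
      by_cases hadj : G.Adj u v <;> simp [huv, hju, hjv, hadj, h2]
    · by_cases hadj : G.Adj u v <;> simp [huv, hju, hjv, hadj]
  · simp

theorem err_of_retired {t : ℕ} {u v : V} (ht : t ≤ Fintype.card V)
    (hu : u ∈ unclustered G (threshold V c ε) π B t) (h : ¬ Alive G (threshold V c ε) t u) :
    err G (truncatedClustering G c ε π fun u v => B u v = true) u v =
      if G.Adj u v then 1 else 0 := by
  unfold err
  by_cases huv : u = v
  · simp [huv]
  · simp [huv, truncatedClustering_of_not_alive ht hu h huv]

/-- Retired vertices are singletons, so only positive edges cost anything, and `hret` splits each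
cost into weight and mass. An edge is found from either endpoint, hence the factor `2 * κ`. -/
theorem pairSum_err_retire {q x : V → V → ℝ} {α κ : ℝ} (hα : 0 ≤ α) (hκ : 0 ≤ κ)
    (hq : ∀ u v, 0 ≤ q u v) (hsymm : ∀ u v, q u v = q v u) (hlp : ∀ u v, 0 ≤ lpWeight G x u v)
    (hret : ∀ u v, G.Adj u v → 1 ≤ α * lpWeight G x u v + κ * q u v) {t : ℕ}
    (ht : t ≤ Fintype.card V) :
    pairSum (err G (truncatedClustering G c ε π fun u v => B u v = true))
        (unclustered G (threshold V c ε) π B t) -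
      pairSum (err G (truncatedClustering G c ε π fun u v => B u v = true))
        (alive G (threshold V c ε) t (unclustered G (threshold V c ε) π B t)) ≤
      α * (pairSum (lpWeight G x) (unclustered G (threshold V c ε) π B t) -
        pairSum (lpWeight G x)
          (alive G (threshold V c ε) t (unclustered G (threshold V c ε) π B t))) +
      2 * κ * ∑ u ∈ unclustered G (threshold V c ε) π B t with ¬ Alive G (threshold V c ε) t u,
        mass G q u (unclustered G (threshold V c ε) π B t) := by
  set U := unclustered G (threshold V c ε) π B t with hU
  have h1 : ∑ u ∈ U with ¬ Alive G (threshold V c ε) t u, mass G q u U =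
      pairSum (fun u v => if ¬ Alive G (threshold V c ε) t u then
        (if G.Adj u v then q u v else 0) else 0) U := by
    rw [Finset.sum_filter]
    refine Finset.sum_congr rfl fun u _ => ?_
    by_cases h : Alive G (threshold V c ε) t u <;> simp [h, mass]
  have h2 : ∑ u ∈ U with ¬ Alive G (threshold V c ε) t u, mass G q u U =
      pairSum (fun u v => if ¬ Alive G (threshold V c ε) t v then
        (if G.Adj u v then q u v else 0) else 0) U := by
    rw [h1, pairSum, Finset.sum_comm]
    simp only [pairSum, hsymm, G.adj_comm]
  have h3 : 2 * κ * ∑ u ∈ U with ¬ Alive G (threshold V c ε) t u, mass G q u U =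
      pairSum (fun u v => κ * ((if ¬ Alive G (threshold V c ε) t u then
        (if G.Adj u v then q u v else 0) else 0) + (if ¬ Alive G (threshold V c ε) t v then
        (if G.Adj u v then q u v else 0) else 0))) U := by
    rw [pairSum_mul, pairSum_add, ← h1, ← h2]; ring
  rw [h3, alive, pairSum_filter, pairSum_filter, ← pairSum_sub, ← pairSum_sub, ← pairSum_mul,
    ← pairSum_add]
  refine pairSum_mono fun u hu v hv => ?_
  have hl := mul_nonneg hα (hlp u v)
  have hkq := mul_nonneg hκ (hq u v)
  by_cases hau : Alive G (threshold V c ε) t u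
  · by_cases hav : Alive G (threshold V c ε) t v
    · simp [hau, hav]
    · rw [err_comm, err_of_retired ht hv hav, G.adj_comm]
      by_cases hadj : G.Adj u v
      · have := hret u v hadj
        simp [hau, hav, hadj]; linarith
      · simp [hau, hav, hadj]; linarith
  · rw [err_of_retired ht hu hau]
    by_cases hadj : G.Adj u v
    · have := hret u v hadj
      by_cases hav : Alive G (threshold V c ε) t v <;> simp [hau, hav, hadj] <;> linarith
    · by_cases hav : Alive G (threshold V c ε) t v <;> simp [hau, hav, hadj] <;> linarith

/-- A retired vertex causes as many disagreements as its degree. The right side telescopes, so the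
retired degrees sum to at most twice the cost, which permits the absorption of `δ * deg`. -/
theorem sum_degree_retired (t : Fin (Fintype.card V)) :
    ∑ u ∈ unclustered G (threshold V c ε) π B t with ¬ Alive G (threshold V c ε) t u,
        (G.degree u : ℝ) ≤
      ∑ u ∈ unclustered G (threshold V c ε) π B t, ∑ v,
          err G (truncatedClustering G c ε π fun u v => B u v = true) u v -
        ∑ u ∈ unclustered G (threshold V c ε) π B (t + 1), ∑ v,
          err G (truncatedClustering G c ε π fun u v => B u v = true) u v := by
  have hsub : unclustered G (threshold V c ε) π B (t + 1) ⊆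
      (unclustered G (threshold V c ε) π B t).filter (Alive G (threshold V c ε) t) := by
    rw [unclustered_succ]; exact afterPivot_subset _ _ _
  have h1 := Finset.sum_le_sum_of_subset_of_nonneg (f := fun u => ∑ v,
    err G (truncatedClustering G c ε π fun u v => B u v = true) u v) hsub
    (fun u _ _ => Finset.sum_nonneg fun v _ => err_nonneg G _ u v)
  have h2 := Finset.sum_filter_add_sum_filter_not (unclustered G (threshold V c ε) π B t)
    (Alive G (threshold V c ε) t) (fun u => ∑ v,
      err G (truncatedClustering G c ε π fun u v => B u v = true) u v)
  have h3 : ∑ u ∈ unclustered G (threshold V c ε) π B t with ¬ Alive G (threshold V c ε) t u,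
        (G.degree u : ℝ) =
      ∑ u ∈ unclustered G (threshold V c ε) π B t with ¬ Alive G (threshold V c ε) t u, ∑ v,
        err G (truncatedClustering G c ε π fun u v => B u v = true) u v := by
    refine Finset.sum_congr rfl fun u hu => ?_
    rw [Finset.mem_filter] at hu
    simp only [err_of_retired t.2.le hu.1 hu.2]
    rw [Finset.sum_boole, ← G.card_neighborFinset_eq_degree]
    congr 2
    ext v; simp
  linarith

theorem sum_fin_sub {n : ℕ} (f : ℕ → ℝ) : ∑ t : Fin n, (f t - f (t + 1)) = f 0 - f n := by
  rw [Fin.sum_univ_eq_sum_range (fun t => f t - f (t + 1)) n, Finset.sum_range_sub']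

/-- A pointwise bound: three potentials telescope, namely the errors inside the unclustered set, the
weights inside it, and the errors at its vertices. The last pays for light retirements; what remains
is a pivot term that is nonpositive on average and an error from heavy retirements. -/
theorem two_mul_cost_le {q x : V → V → ℝ} {α κ δ : ℝ} (hα : 0 ≤ α) (hκ : 0 ≤ κ) (hδ : 0 ≤ δ)
    (hq : ∀ u v, 0 ≤ q u v) (hq1 : ∀ u v, q u v ≤ 1) (hsymm : ∀ u v, q u v = q v u)
    (hlp : ∀ u v, 0 ≤ lpWeight G x u v)
    (hret : ∀ u v, G.Adj u v → 1 ≤ α * lpWeight G x u v + κ * q u v) :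
    (1 - 2 * κ * δ) * (2 * cost G (truncatedClustering G c ε π fun u v => B u v = true)) ≤
      α * pairSum (lpWeight G x) Finset.univ +
      ∑ t : Fin (Fintype.card V),
        (pivotCharge G (alive G (threshold V c ε) t (unclustered G (threshold V c ε) π B t))
            (π.symm t) (B (π.symm t)) -
          α * (pairSum (lpWeight G x)
              (alive G (threshold V c ε) t (unclustered G (threshold V c ε) π B t)) -
            pairSum (lpWeight G x) (afterPivot
              (alive G (threshold V c ε) t (unclustered G (threshold V c ε) π B t))
              (π.symm t) (B (π.symm t))))) +
      2 * κ * Fintype.card V * ∑ t : Fin (Fintype.card V),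
        ∑ u ∈ unclustered G (threshold V c ε) π B t with ¬ Alive G (threshold V c ε) t u,
          heavy G q δ u (unclustered G (threshold V c ε) π B t) := by
  set C := truncatedClustering G c ε π fun u v => B u v = true with hC
  set U := unclustered G (threshold V c ε) π B with hU
  have e1 := sum_fin_sub (n := Fintype.card V) (fun t => pairSum (err G C) (U t))
  have e2 := sum_fin_sub (n := Fintype.card V) (fun t => pairSum (lpWeight G x) (U t))
  have e3 := sum_fin_sub (n := Fintype.card V) (fun t => ∑ u ∈ U t, ∑ v, err G C u v)
  have hUn : U (Fintype.card V) = ∅ := unclustered_card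
  have hU0 : U 0 = Finset.univ := rfl
  simp only [hUn, hU0, pairSum, Finset.sum_empty, sub_zero] at e1 e2 e3
  rw [← two_mul_cost] at e1 e3
  have step : ∀ t : Fin (Fintype.card V), pairSum (err G C) (U t) - pairSum (err G C) (U (t + 1)) ≤
      α * (pairSum (lpWeight G x) (U t) - pairSum (lpWeight G x) (U (t + 1))) +
      (pivotCharge G (alive G (threshold V c ε) t (U t)) (π.symm t) (B (π.symm t)) -
          α * (pairSum (lpWeight G x) (alive G (threshold V c ε) t (U t)) -
            pairSum (lpWeight G x) (afterPivot (alive G (threshold V c ε) t (U t))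
              (π.symm t) (B (π.symm t))))) +
      2 * κ * Fintype.card V * ∑ u ∈ U t with ¬ Alive G (threshold V c ε) t u,
          heavy G q δ u (U t) +
      2 * κ * δ * (∑ u ∈ U t, ∑ v, err G C u v - ∑ u ∈ U (t + 1), ∑ v, err G C u v) := by
    intro t
    have h1 := pairSum_err_pivot (G := G) (c := c) (ε := ε) (π := π) (B := B) t
    have h2 := pairSum_err_retire (c := c) (ε := ε) (π := π) (B := B) hα hκ hq hsymm hlp hret t.2.le
    have h3 := sum_degree_retired (G := G) (c := c) (ε := ε) (π := π) (B := B) t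
    have h4 : U (t + 1) = afterPivot (alive G (threshold V c ε) t (U t))
              (π.symm t) (B (π.symm t)) := unclustered_succ t
    have h5 : ∑ u ∈ U t with ¬ Alive G (threshold V c ε) t u, mass G q u (U t) ≤
        δ * ∑ u ∈ U t with ¬ Alive G (threshold V c ε) t u, (G.degree u : ℝ) +
        Fintype.card V * ∑ u ∈ U t with ¬ Alive G (threshold V c ε) t u,
          heavy G q δ u (U t) := by
      rw [Finset.mul_sum, Finset.mul_sum, ← Finset.sum_add_distrib]
      exact Finset.sum_le_sum fun u _ => mass_le_add_heavy hq1 hδ u _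
    rw [← hC, ← hU] at h1 h2 h3
    have h6 := mul_le_mul_of_nonneg_left h5 hκ
    have h7 := mul_le_mul_of_nonneg_left h3 (mul_nonneg hκ hδ)
    rw [← h4]
    linarith
  have total := Finset.sum_le_sum fun t (_ : t ∈ (Finset.univ : Finset (Fin (Fintype.card V)))) =>
    step t
  simp only [Finset.sum_add_distrib, ← Finset.mul_sum] at total
  simp only [pairSum] at total ⊢
  rw [e1, e2, e3] at total
  linarith

end Charge

/-! ### Expectations -/

/-- The expected cost minus `α` times the expected weight at the pair `u`, `v`, when `w` is made a
pivot. -/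
noncomputable def stepTerm {V : Type*} (G : SimpleGraph V) (q x : V → V → ℝ) (α : ℝ)
    (w u v : V) : ℝ :=
  charge G u v (joinProb q w u) (joinProb q w v) -
    α * (lpWeight G x u v * (1 - (1 - joinProb q w u) * (1 - joinProb q w v)))

/-- The acceptance probabilities `q` round the fractional clustering `x` with ratio `α`. -/
structure IsRounding {V : Type*} (G : SimpleGraph V) (q x : V → V → ℝ) (α : ℝ) : Prop where
  ratio_nonneg : 0 ≤ α
  nonneg : ∀ u v, 0 ≤ q u v
  le_one : ∀ u v, q u v ≤ 1
  symm : ∀ u v, q u v = q v u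
  weight_nonneg : ∀ u v, 0 ≤ lpWeight G x u v
  one_le : ∀ u v, G.Adj u v → 1 ≤ α * lpWeight G x u v + q u v
  pair_left : ∀ w v, w ≠ v → stepTerm G q x α w w v ≤ 0
  pair_right : ∀ w v, w ≠ v → stepTerm G q x α w v w ≤ 0
  triple : ∀ u v w, u ≠ v → v ≠ w → u ≠ w →
    stepTerm G q x α w u v + stepTerm G q x α u v w + stepTerm G q x α v w u ≤ 0

theorem stepTerm_self {V : Type*} (G : SimpleGraph V) (q x : V → V → ℝ) (α : ℝ) (w u : V) :
    stepTerm G q x α w u u = 0 := by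
  simp [stepTerm, charge, lpWeight]

/-- Summing over the three rotations of `(w, u, v)` triples the sum and makes each summand one
triangle inequality, or a pair inequality when two vertices coincide. -/
theorem IsRounding.sum_stepTerm_le {V : Type*} {G : SimpleGraph V} {q x : V → V → ℝ} {α : ℝ}
    (h : IsRounding G q x α) (W : Finset V) :
    ∑ w ∈ W, ∑ u ∈ W, ∑ v ∈ W, stepTerm G q x α w u v ≤ 0 := by
  have e1 : ∑ w ∈ W, ∑ u ∈ W, ∑ v ∈ W, stepTerm G q x α w u v =
      ∑ w ∈ W, ∑ u ∈ W, ∑ v ∈ W, stepTerm G q x α u v w := by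
    symm
    rw [Finset.sum_comm]
    exact Finset.sum_congr rfl fun a _ => Finset.sum_comm
  have e2 : ∑ w ∈ W, ∑ u ∈ W, ∑ v ∈ W, stepTerm G q x α w u v =
      ∑ w ∈ W, ∑ u ∈ W, ∑ v ∈ W, stepTerm G q x α v w u := by
    symm
    rw [Finset.sum_comm]
    exact (Finset.sum_congr rfl fun a _ => Finset.sum_comm).trans
      (Finset.sum_comm.trans (Finset.sum_congr rfl fun a _ => Finset.sum_comm)) 
  have e3 : ∑ w ∈ W, ∑ u ∈ W, ∑ v ∈ W, (stepTerm G q x α w u v + stepTerm G q x α u v w +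
      stepTerm G q x α v w u) ≤ 0 := by
    refine Finset.sum_nonpos fun w _ => Finset.sum_nonpos fun u _ => Finset.sum_nonpos fun v _ => ?_
    by_cases huv : u = v
    · subst huv
      by_cases huw : u = w
      · subst huw; simp [stepTerm_self]
      · have := h.pair_right u w huw
        have := h.pair_left u w huw
        rw [stepTerm_self]; linarith
    · by_cases hvw : v = w
      · subst hvw
        have := h.pair_right v u (Ne.symm huv)
        have := h.pair_left v u (Ne.symm huv)
        rw [stepTerm_self]; linarith
      · by_cases huw : u = w
        · subst huw
          have := h.pair_right u v huv
          have := h.pair_left u v huv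
          rw [stepTerm_self]; linarith
        · exact h.triple u v w huv hvw huw
  simp only [Finset.sum_add_distrib] at e3
  linarith

/-! ### One step in expectation, and the survival of heavy vertices. -/

section Step

variable {V : Type*} [Fintype V] {G : SimpleGraph V} {q x : V → V → ℝ} {α : ℝ}

/-- The charge and the removed weight at a pair of distinct vertices are polynomials of degree at
most one in each of the two independent indicators `joins`, so averaging replaces these by
`joinProb`. -/
theorem sum_rowProb_stepTerm (W : Finset V) {w : V} (hw : w ∈ W) :
    ∑ b, rowProb (q w) b * (pivotCharge G W w b -
      α * (pairSum (lpWeight G x) W - pairSum (lpWeight G x) (afterPivot W w b))) =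
    ∑ u ∈ W, ∑ v ∈ W, stepTerm G q x α w u v := by
  have h1 : ∀ b : V → Bool, pivotCharge G W w b -
      α * (pairSum (lpWeight G x) W - pairSum (lpWeight G x) (afterPivot W w b)) =
      ∑ u ∈ W, ∑ v ∈ W, (charge G u v (joins w b u) (joins w b v) -
        α * (lpWeight G x u v * (1 - (1 - joins w b u) * (1 - joins w b v)))) := fun b => by
    rw [pivotCharge, if_pos hw, afterPivot, if_pos hw, pairSum_filter, ← pairSum_sub,
      ← pairSum_mul, ← pairSum_sub]
    refine Finset.sum_congr rfl fun u _ => Finset.sum_congr rfl fun v _ => ?_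
    unfold joins
    by_cases hju : u = w ∨ b u = true <;> by_cases hjv : v = w ∨ b v = true <;> simp [hju, hjv]
  simp_rw [h1, Finset.mul_sum]
  rw [Finset.sum_comm]
  refine Finset.sum_congr rfl fun u _ => ?_
  rw [Finset.sum_comm]
  refine Finset.sum_congr rfl fun v _ => ?_
  by_cases huv : u = v
  · subst huv
    simp [stepTerm_self, charge, lpWeight]
  · have a0 := sum_rowProb (q w)
    have a1 := sum_rowProb_mul_joins q w u
    have a2 := sum_rowProb_mul_joins q w v
    have a3 := sum_rowProb_mul_joins_mul_joins q w huv
    have lin : ∀ k1 k2 k3 : ℝ, ∑ b : V → Bool, rowProb (q w) b *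
        (k1 * joins w b u + k2 * joins w b v + k3 * (joins w b u * joins w b v)) =
        k1 * joinProb q w u + k2 * joinProb q w v + k3 * (joinProb q w u * joinProb q w v) := by
      intro k1 k2 k3
      rw [← a3, ← a1, ← a2, Finset.mul_sum, Finset.mul_sum, Finset.mul_sum,
        ← Finset.sum_add_distrib, ← Finset.sum_add_distrib]
      exact Finset.sum_congr rfl fun b _ => by ring
    unfold stepTerm charge
    rw [if_neg huv]
    by_cases hadj : G.Adj u v
    · have := lin (1 - α * lpWeight G x u v) (1 - α * lpWeight G x u v)
        (-2 + α * lpWeight G x u v)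
      rw [if_pos hadj]
      refine Eq.trans (Finset.sum_congr rfl fun b _ => ?_) (this.trans ?_)
      · rw [if_neg huv, if_pos hadj]; ring
      · ring
    · have := lin (-(α * lpWeight G x u v)) (-(α * lpWeight G x u v))
        (1 + α * lpWeight G x u v)
      rw [if_neg hadj]
      refine Eq.trans (Finset.sum_congr rfl fun b _ => ?_) (this.trans ?_)
      · rw [if_neg huv, if_neg hadj]; ring
      · ring

theorem sum_rowProb_mul_afterPivot (W : Finset V) (u : V) (hu : u ∈ W) (w : V) :
    ∑ b, rowProb (q w) b * (if u ∈ afterPivot W w b then 1 else 0) =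
      1 - if w ∈ W then joinProb q w u else 0 := by
  by_cases hw : w ∈ W
  · have : ∀ b : V → Bool, rowProb (q w) b * (if u ∈ afterPivot W w b then (1 : ℝ) else 0) =
        rowProb (q w) b - rowProb (q w) b * joins w b u := fun b => by
      rw [afterPivot, if_pos hw, joins]
      by_cases hj : u = w ∨ b u = true
      · rw [if_neg (by rw [Finset.mem_filter]; exact fun h => h.2 hj), if_pos hj]; ring
      · rw [if_pos (Finset.mem_filter.2 ⟨hu, hj⟩), if_neg hj]; ring
    simp_rw [this]
    rw [Finset.sum_sub_distrib, sum_rowProb, sum_rowProb_mul_joins, if_pos hw]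
  · simp [afterPivot, hw, hu, sum_rowProb]

variable {M : ℝ}

theorem IsRounding.expect_step_nonpos (h : IsRounding G q x α) (t : Fin (Fintype.card V)) :
    expect q (fun π B =>
      pivotCharge G (alive G M t (unclustered G M π B t)) (π.symm t) (B (π.symm t)) -
        α * (pairSum (lpWeight G x) (alive G M t (unclustered G M π B t)) -
          pairSum (lpWeight G x) (afterPivot (alive G M t (unclustered G M π B t))
            (π.symm t) (B (π.symm t))))) ≤ 0 := by
  have key := expect_step q t (fun π B => unclustered G M π B t)
    (fun π B s hs => unclustered_swap hs le_rfl)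
    (fun π B w b hw => unclustered_update (Fin.le_def.1 hw))
    (fun U w b => pivotCharge G (alive G M t U) w b - α * (pairSum (lpWeight G x) (alive G M t U) -
          pairSum (lpWeight G x) (afterPivot (alive G M t U) w b)))
  have hpos : (0 : ℝ) < (Fintype.card V : ℝ) - (t : ℕ) := by
    have : ((t : ℕ) : ℝ) < Fintype.card V := by exact_mod_cast t.2
    linarith
  refine nonpos_of_mul_nonpos_right (key.trans_le ?_) hpos
  have h0 := expect_const q 0
  rw [mul_zero] at h0
  rw [← h0]
  refine expect_mono h.nonneg h.le_one fun π B => ?_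
  refine le_trans (le_of_eq ?_) (h.sum_stepTerm_le (alive G M t (unclustered G M π B t)))
  have hsub : alive G M t (unclustered G M π B t) ⊆ Finset.univ.filter fun w => t ≤ π w :=
    fun w hw => by
      have := le_of_mem_unclustered (mem_alive.1 hw).1
      simpa using this
  rw [← Finset.sum_subset hsub]
  · exact Finset.sum_congr rfl fun w hw => sum_rowProb_stepTerm _ hw
  · intro w _ hw
    refine Finset.sum_eq_zero fun b _ => ?_
    simp [pivotCharge, afterPivot, hw]

/-- The indicator that `u` is unclustered at time `t` although its mass is large. -/
noncomputable def heavyAt (G : SimpleGraph V) (q : V → V → ℝ) (M δ : ℝ) (u : V) (t : ℕ)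
    (π : V ≃ Fin (Fintype.card V)) (B : V → V → Bool) : ℝ :=
  if u ∈ unclustered G M π B t then heavy G q δ u (unclustered G M π B t) else 0

/-- At most `n - t` candidates remain for position `t`, and together they take `u` with total weight
at least `mass G q u W > δ * deg u`; the factor is weakened from `n - t` to `n`. -/
theorem IsRounding.expect_heavyAt_succ (h : IsRounding G q x α) {δ : ℝ} (hδ : 0 ≤ δ) (hδ1 : δ ≤ 1)
    (u : V) (t : Fin (Fintype.card V)) :
    expect q (heavyAt G q M δ u (t + 1)) ≤
      (1 - δ * G.degree u / Fintype.card V) * expect q (heavyAt G q M δ u t) := by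
  have hdeg : (G.degree u : ℝ) ≤ Fintype.card V := by exact_mod_cast (G.degree_lt_card_verts u).le
  have hn : (0 : ℝ) < Fintype.card V := by exact_mod_cast t.pos
  have ht : ((t : ℕ) : ℝ) < Fintype.card V := by exact_mod_cast t.2
  have key := expect_step q t (fun π B => unclustered G M π B t)
    (fun π B s hs => unclustered_swap hs le_rfl)
    (fun π B w b hw => unclustered_update (Fin.le_def.1 hw))
    (fun U w b => if u ∈ afterPivot (alive G M t U) w b then
      heavy G q δ u (afterPivot (alive G M t U) w b) else 0)
  have hpos : (0 : ℝ) < (Fintype.card V : ℝ) - (t : ℕ) := by linarith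
  have e1 : expect q (heavyAt G q M δ u (t + 1)) = expect q (fun π B =>
      if u ∈ afterPivot (alive G M t (unclustered G M π B t)) (π.symm t) (B (π.symm t)) then
      heavy G q δ u (afterPivot (alive G M t (unclustered G M π B t)) (π.symm t) (B (π.symm t)))
      else 0) := by
    congr 1
    funext π B
    rw [heavyAt, unclustered_succ]
  rw [← e1] at key
  refine le_of_mul_le_mul_left (key.trans_le ?_) hpos
  rw [← mul_assoc, ← expect_mul]
  refine expect_mono h.nonneg h.le_one fun π B => ?_
  set U := unclustered G M π B t with hU
  set W := alive G M t U with hW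
  have hfac : 0 ≤ 1 - δ * G.degree u / Fintype.card V := by
    rw [sub_nonneg, div_le_one hn]
    nlinarith
  have hWU : W ⊆ U := Finset.filter_subset _ _
  have hrhs : 0 ≤ ((Fintype.card V : ℝ) - (t : ℕ)) * (1 - δ * G.degree u / Fintype.card V) *
      heavyAt G q M δ u t π B := by
    refine mul_nonneg (mul_nonneg hpos.le hfac) ?_
    unfold heavyAt; split_ifs
    · exact heavy_nonneg _ _ _ _ _
    · exact le_rfl
  -- The mass only decreases as vertices leave, so if `u` is retired or light in `W` it cannot be
  -- unclustered and heavy afterwards, and the left side vanishes.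
  by_cases hbad : u ∈ W ∧ δ * (G.degree u : ℝ) < mass G q u W
  · have hone : heavyAt G q M δ u t π B = 1 := by
      rw [heavyAt, if_pos (hWU hbad.1), heavy, if_pos (hbad.2.trans_le (mass_mono h.nonneg hWU))]
    rw [hone, mul_one]
    calc ∑ w with t ≤ π w, ∑ b, rowProb (q w) b *
          (if u ∈ afterPivot W w b then heavy G q δ u (afterPivot W w b) else 0)
        ≤ ∑ w with t ≤ π w, ∑ b, rowProb (q w) b * (if u ∈ afterPivot W w b then 1 else 0) := by
          refine Finset.sum_le_sum fun w _ => Finset.sum_le_sum fun b _ => ?_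
          refine mul_le_mul_of_nonneg_left ?_ (rowProb_nonneg (h.nonneg w) (h.le_one w) b)
          unfold heavy
          split_ifs <;> norm_num
      _ = ∑ w with t ≤ π w, (1 - if w ∈ W then joinProb q w u else 0) :=
          Finset.sum_congr rfl fun w _ => sum_rowProb_mul_afterPivot W u hbad.1 w
      _ = ((Fintype.card V : ℝ) - (t : ℕ)) - ∑ w ∈ W, joinProb q w u := by
          have hsub : W ⊆ Finset.univ.filter fun w => t ≤ π w := fun w hw => by
            have := le_of_mem_unclustered (hWU hw)
            simpa using this
          have hcard : ((Finset.univ.filter fun w => t ≤ π w).card : ℝ) =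
              (Fintype.card V : ℝ) - (t : ℕ) := by
            have : (Finset.univ.filter fun w => t ≤ π w) = (Finset.Ici t).map π.symm.toEmbedding := by
              ext w; simp
            rw [this, Finset.card_map, Fin.card_Ici, Nat.cast_sub t.2.le]
          rw [Finset.sum_sub_distrib, Finset.sum_const, nsmul_eq_mul, mul_one, hcard]
          congr 1
          rw [← Finset.sum_filter]
          refine Finset.sum_congr ?_ fun _ _ => rfl
          ext w
          simp only [Finset.mem_filter]
          exact ⟨fun h' => h'.2, fun h' => ⟨by simpa using hsub h', h'⟩⟩
      _ ≤ ((Fintype.card V : ℝ) - (t : ℕ)) - mass G q u W := by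
          refine sub_le_sub_left (Finset.sum_le_sum fun w _ => ?_) _
          unfold joinProb
          split_ifs with h1 h2
          · exact h.le_one u w
          · exact (h.symm u w).le
          · norm_num
          · exact h.nonneg w u
      _ ≤ ((Fintype.card V : ℝ) - (t : ℕ)) - δ * G.degree u := by linarith [hbad.2]
      _ ≤ ((Fintype.card V : ℝ) - (t : ℕ)) * (1 - δ * G.degree u / Fintype.card V) := by
          have : 0 ≤ ((t : ℕ) : ℝ) * (δ * G.degree u / Fintype.card V) := by positivity
          have h2 : (Fintype.card V : ℝ) * (δ * G.degree u / Fintype.card V) = δ * G.degree u := by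
            field_simp
          linarith
  · refine le_trans (le_of_eq ?_) hrhs
    refine Finset.sum_eq_zero fun w _ => Finset.sum_eq_zero fun b _ => ?_
    have hsub := afterPivot_subset W w b
    by_cases hu : u ∈ afterPivot W w b
    · have : ¬ δ * (G.degree u : ℝ) < mass G q u (afterPivot W w b) := fun h' =>
        hbad ⟨hsub hu, h'.trans_le (mass_mono h.nonneg hsub)⟩
      simp [heavy, this]
    · simp [hu]

theorem IsRounding.expect_heavyAt_le (h : IsRounding G q x α) {δ : ℝ} (hδ : 0 ≤ δ) (hδ1 : δ ≤ 1)
    (u : V) {t : ℕ} (ht : t ≤ Fintype.card V) :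
    expect q (heavyAt G q M δ u t) ≤
      (Fintype.card V).factorial * Real.exp (-(δ * G.degree u / Fintype.card V * t)) := by
  induction t with
  | zero =>
    have h1 := expect_const q 1
    simp only [CharP.cast_eq_zero, mul_zero, neg_zero, Real.exp_zero]
    rw [← h1]
    refine expect_mono h.nonneg h.le_one fun π B => ?_
    unfold heavyAt heavy
    split_ifs <;> norm_num
  | succ t ih =>
    have h1 := h.expect_heavyAt_succ (M := M) hδ hδ1 u ⟨t, ht⟩
    have h2 := ih (Nat.le_of_succ_le ht)
    have h3 : 0 ≤ expect q (heavyAt G q M δ u t) := by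
      have h0 := expect_const q 0
      rw [mul_zero] at h0
      rw [← h0]
      refine expect_mono h.nonneg h.le_one fun π B => ?_
      unfold heavyAt heavy
      split_ifs <;> norm_num
    have h4 : 1 - δ * G.degree u / Fintype.card V ≤
        Real.exp (-(δ * G.degree u / Fintype.card V)) := by
      have := Real.add_one_le_exp (-(δ * G.degree u / Fintype.card V))
      linarith
    calc _ ≤ _ := h1
      _ ≤ Real.exp (-(δ * G.degree u / Fintype.card V)) * expect q (heavyAt G q M δ u t) :=
          mul_le_mul_of_nonneg_right h4 h3
      _ ≤ Real.exp (-(δ * G.degree u / Fintype.card V)) * ((Fintype.card V).factorial *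
            Real.exp (-(δ * G.degree u / Fintype.card V * t))) :=
          mul_le_mul_of_nonneg_left h2 (Real.exp_pos _).le
      _ = _ := by
          rw [mul_left_comm, ← Real.exp_add]
          congr 2
          push_cast
          ring

end Step

/-! ### The expected cost of a truncated pivot algorithm -/

/-- The pivot terms are nonpositive in expectation. The three factors `n` of the error come from the
times, the vertices, and the trivial bound `n` on a heavy mass. -/
theorem IsRounding.expect_cost_le {V : Type*} [Fintype V] {G : SimpleGraph V} {q x : V → V → ℝ}
    {α : ℝ} (h : IsRounding G q x α) {δ c ε η : ℝ} (hδ : 0 ≤ δ) (hδ1 : δ ≤ 1) (hη0 : 0 ≤ η)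
    (hη : ∀ (u : V) (t : ℕ), t < Fintype.card V → ¬ Alive G (threshold V c ε) t u →
      Real.exp (-(δ * G.degree u / Fintype.card V * t)) ≤ η) :
    (1 - 2 * δ) * expect q (fun π B =>
        (cost G (truncatedClustering G c ε π fun u v => B u v = true) : ℝ)) ≤
      (Fintype.card V).factorial * (α * (pairSum (lpWeight G x) Finset.univ / 2) +
        (Fintype.card V : ℝ) ^ 3 * η) := by
  have h1 := expect_mono h.nonneg h.le_one (fun π B => two_mul_cost_le (c := c) (ε := ε) (π := π)
    (B := B) h.ratio_nonneg zero_le_one hδ h.nonneg h.le_one h.symm h.weight_nonneg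
    (fun u v huv => by simpa using h.one_le u v huv))
  rw [expect_mul, expect_mul, expect_add, expect_add, expect_const, expect_mul, expect_sum,
    expect_sum] at h1
  have h2 := Finset.sum_nonpos fun t (_ : t ∈ (Finset.univ : Finset (Fin (Fintype.card V)))) =>
    h.expect_step_nonpos (M := threshold V c ε) t
  have h3 : ∀ t : Fin (Fintype.card V), expect q (fun π B =>
      ∑ u ∈ unclustered G (threshold V c ε) π B t with ¬ Alive G (threshold V c ε) t u,
        heavy G q δ u (unclustered G (threshold V c ε) π B t)) ≤
      Fintype.card V * ((Fintype.card V).factorial * η) := by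
    intro t
    have e : ∀ (π : V ≃ Fin (Fintype.card V)) (B : V → V → Bool),
        ∑ u ∈ unclustered G (threshold V c ε) π B t with ¬ Alive G (threshold V c ε) t u,
          heavy G q δ u (unclustered G (threshold V c ε) π B t) =
        ∑ u with ¬ Alive G (threshold V c ε) t u,
          heavyAt G q (threshold V c ε) δ u t π B := by
      intro π B
      simp only [heavyAt]
      rw [← Finset.sum_filter, Finset.filter_filter]
      refine Finset.sum_congr ?_ fun _ _ => rfl
      ext v
      simp [and_comm]
    simp only [e]
    rw [expect_sum]
    calc ∑ u with ¬ Alive G (threshold V c ε) t u,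
          expect q (heavyAt G q (threshold V c ε) δ u t)
        ≤ ∑ u : V with ¬ Alive G (threshold V c ε) t u, ((Fintype.card V).factorial : ℝ) * η := by
          refine Finset.sum_le_sum fun u hu => (h.expect_heavyAt_le hδ hδ1 u t.2.le).trans ?_
          exact mul_le_mul_of_nonneg_left (hη u t t.2 (Finset.mem_filter.1 hu).2) (by positivity)
      _ ≤ Fintype.card V * ((Fintype.card V).factorial * η) := by
          rw [Finset.sum_const, nsmul_eq_mul]
          refine mul_le_mul_of_nonneg_right ?_ (by positivity)
          exact_mod_cast Finset.card_le_univ _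
  have h4 := Finset.sum_le_sum fun t (_ : t ∈ (Finset.univ : Finset (Fin (Fintype.card V)))) => h3 t
  rw [Finset.sum_const, Finset.card_univ, Fintype.card_fin, nsmul_eq_mul] at h4
  have h5 := mul_le_mul_of_nonneg_left h4 (show (0 : ℝ) ≤ 2 * 1 * Fintype.card V by positivity)
  linarith

/-! ### The two algorithms as roundings -/

/-- The distances of any clustering `C` form a 0/1 metric, so the triangle condition is a finite
check; transitivity of `C` excludes exactly two of three pairs being together. With `C` optimal the
total weight is the optimum. -/
theorem isRounding_pivot {V : Type*} (G : SimpleGraph V) (C : Setoid V) :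
    IsRounding G (fun u v => if G.Adj u v then 1 else 0) (fun u v => if C u v then 0 else 1) 3 where
  ratio_nonneg := by norm_num
  nonneg u v := by split_ifs <;> norm_num
  le_one u v := by split_ifs <;> norm_num
  symm u v := by simp only [G.adj_comm]
  weight_nonneg u v := by
    unfold lpWeight
    by_cases hC : C u v <;> simp only [hC, if_true, if_false] <;> split_ifs <;> norm_num
  one_le u v huv := by
    have hne := huv.ne
    unfold lpWeight
    by_cases hC : C u v <;> simp [huv, hne, hC]
  pair_left w v hwv := by
    by_cases hC : C w v <;> by_cases hadj : G.Adj w v <;>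
      simp [stepTerm, charge, joinProb, lpWeight, hwv, hwv.symm, hC, hadj]
  pair_right w v hwv := by
    by_cases hC : C v w <;> by_cases hadj : G.Adj v w <;>
      simp [stepTerm, charge, joinProb, lpWeight, hwv.symm, hC, hadj, G.adj_comm w v]
  triple u v w huv hvw huw := by
    have hvu := huv.symm
    have hwv := hvw.symm
    have hwu := huw.symm
    have t1 : C u v → C v w → C w u := fun h1 h2 => C.symm (C.trans h1 h2)
    have t2 : C v w → C w u → C u v := fun h1 h2 => C.symm (C.trans h1 h2)
    have t3 : C w u → C u v → C v w := fun h1 h2 => C.symm (C.trans h1 h2)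
    simp only [stepTerm, charge, joinProb, lpWeight, huv, hvw, huw, hvu, hwv, hwu, if_false,
      G.adj_comm v u, G.adj_comm w v, G.adj_comm u w]
    by_cases a1 : G.Adj u v <;> by_cases a2 : G.Adj v w <;> by_cases a3 : G.Adj w u <;>
      simp only [a1, a2, a3, if_true, if_false] <;>
      by_cases c1 : C u v <;> by_cases c2 : C v w <;> by_cases c3 : C w u <;>
      first
      | exact absurd (t1 c1 c2) c3
      | exact absurd (t2 c2 c3) c1
      | exact absurd (t3 c3 c1) c2
      | (simp only [c1, c2, c3, if_true, if_false]; norm_num)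

theorem rejectProb_comm {V : Type*} (G : SimpleGraph V) (d : Sym2 V → unitInterval) (u v : V) :
    rejectProb G d u v = rejectProb G d v u := by
  unfold rejectProb
  rw [Sym2.eq_swap]
  simp only [G.adj_comm]

theorem rejectProb_nonneg {V : Type*} (G : SimpleGraph V) (d : Sym2 V → unitInterval) (u v : V) :
    0 ≤ rejectProb G d u v := by
  unfold rejectProb fMinus
  split_ifs
  · exact fPlus_nonneg _
  · exact (d s(u, v)).2.1

theorem rejectProb_le_one {V : Type*} (G : SimpleGraph V) (d : Sym2 V → unitInterval) (u v : V) :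
    rejectProb G d u v ≤ 1 := by
  unfold rejectProb fMinus
  split_ifs
  · exact fPlus_le_one _
  · exact (d s(u, v)).2.2

theorem isRounding_pred {V : Type*} [Fintype V] {G : SimpleGraph V} {β : ℝ}
    {d : Sym2 V → unitInterval} (hd : IsBetaLevel G β d) :
    IsRounding G (fun u v => 1 - rejectProb G d u v) (fun u v => d s(u, v)) 2.06 where
  ratio_nonneg := by norm_num
  nonneg u v := sub_nonneg.2 (rejectProb_le_one G d u v)
  le_one u v := sub_le_self _ (rejectProb_nonneg G d u v)
  symm u v := by rw [rejectProb_comm]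
  weight_nonneg u v := by
    have h1 := (d s(u, v)).2.1
    have h2 := (d s(u, v)).2.2
    unfold lpWeight
    split_ifs
    · exact le_rfl
    · exact h1
    · linarith
  one_le u v huv := by
    have hne := huv.ne
    simp only [lpWeight, rejectProb, huv, hne, if_true, if_false]
    exact fPlus_le_mul_add (d s(u, v)).2.1
  pair_left w v hwv := by
    have h1 := (d s(w, v)).2.1
    have h2 := (d s(w, v)).2.2
    have h3 := fPlus_le_mul h1
    by_cases hadj : G.Adj w v <;>
      simp only [stepTerm, charge, joinProb, lpWeight, rejectProb, fMinus, hwv, hwv.symm, hadj,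
        if_true, if_false] <;> linarith
  pair_right w v hwv := by
    have h1 := (d s(w, v)).2.1
    have h2 := (d s(w, v)).2.2
    have h3 := fPlus_le_mul h1
    by_cases hadj : G.Adj w v <;>
      simp only [stepTerm, charge, joinProb, lpWeight, rejectProb, fMinus, hwv.symm, hadj,
        G.adj_comm v w, Sym2.eq_swap (a := v) (b := w), if_true, if_false] <;> linarith
  triple u v w huv hvw huw := by
    have hvu := huv.symm
    have hwv := hvw.symm
    have hwu := huw.symm
    have t1 := hd.triangle u v w huv hvw huw
    have t2 := hd.triangle v w u hvw hwu hvu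
    have t3 := hd.triangle w u v hwu huv hwv
    have x1 := (d s(u, v)).2.1
    have x2 := (d s(u, v)).2.2
    have y1 := (d s(v, w)).2.1
    have y2 := (d s(v, w)).2.2
    have z1 := (d s(w, u)).2.1
    have z2 := (d s(w, u)).2.2
    rw [Sym2.eq_swap (a := u) (b := w)] at t1
    rw [Sym2.eq_swap (a := v) (b := u)] at t2
    rw [Sym2.eq_swap (a := w) (b := v)] at t3
    simp only [stepTerm, charge, joinProb, lpWeight, rejectProb, fMinus, huv, hvw, huw, hvu, hwv,
      hwu, if_false, G.adj_comm v u, G.adj_comm w v, G.adj_comm u w,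
      Sym2.eq_swap (a := v) (b := u), Sym2.eq_swap (a := w) (b := v),
      Sym2.eq_swap (a := u) (b := w)]
    generalize (d s(u, v) : ℝ) = x at *
    generalize (d s(v, w) : ℝ) = y at *
    generalize (d s(w, u) : ℝ) = z at *
    by_cases a1 : G.Adj u v <;> by_cases a2 : G.Adj v w <;> by_cases a3 : G.Adj w u <;>
      simp only [a1, a2, a3, if_true, if_false]
    · linarith [triangle_pos_pos_pos x1 y1 z1 (by linarith) (by linarith) (by linarith)]
    · linarith [triangle_pos_pos_neg (x := x) (y := y) (z := z) x1 y1 z2 (by linarith)]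
    · linarith [triangle_pos_pos_neg (x := x) (y := z) (z := y) x1 z1 y2 (by linarith)]
    · linarith [triangle_pos_neg_neg (x := x) (y := y) (z := z) x1 x2 y2 z2 (by linarith)
        (by linarith)]
    · linarith [triangle_pos_pos_neg (x := y) (y := z) (z := x) y1 z1 x2 (by linarith)]
    · linarith [triangle_pos_neg_neg (x := y) (y := x) (z := z) y1 y2 x2 z2 (by linarith)
        (by linarith)]
    · linarith [triangle_pos_neg_neg (x := z) (y := x) (z := y) z1 z2 x2 y2 (by linarith)
        (by linarith)]
    · linarith [triangle_neg_neg_neg x1 x2 y1 y2 z1 z2]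

/-! ### The offline algorithm -/

theorem exists_cost_eq_opt {V : Type*} [Fintype V] (G : SimpleGraph V) :
    ∃ C : Setoid V, cost G C = opt G :=
  Nat.sInf_mem (Set.range_nonempty fun C : Setoid V => cost G C)

theorem opt_le_cost {V : Type*} [Fintype V] (G : SimpleGraph V) (C : Setoid V) :
    opt G ≤ cost G C :=
  Nat.sInf_le ⟨C, rfl⟩

theorem coinProb_eq {V : Type*} [Fintype V] (G : SimpleGraph V) (d : Sym2 V → unitInterval)
    (B : V → V → Bool) : coinProb G d B = tableProb (fun u v => 1 - rejectProb G d u v) B := by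
  unfold coinProb tableProb rowProb
  refine Finset.prod_congr rfl fun u _ => Finset.prod_congr rfl fun v _ => ?_
  split_ifs <;> ring

theorem factorial_mul_expectedCost {V : Type*} [Fintype V] (G : SimpleGraph V) (c ε : ℝ)
    (d : Sym2 V → unitInterval) :
    (Fintype.card V).factorial * expectedCost G c ε d =
      expect (fun u v => 1 - rejectProb G d u v) (fun π B => (cost G (offline G c ε π B) : ℝ)) := by
  have : ((Fintype.card V).factorial : ℝ) ≠ 0 := by positivity
  rw [expectedCost, mul_div_cancel₀ _ this]
  simp only [coinProb_eq, expect]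

theorem cost_offline_le_pivot {V : Type*} [Fintype V] (G : SimpleGraph V) (c ε : ℝ)
    (π : V ≃ Fin (Fintype.card V)) (B : V → V → Bool) :
    cost G (offline G c ε π B) ≤ cost G (truncatedPivot G c ε π) := by
  unfold offline
  split_ifs with h
  · exact le_rfl
  · exact (not_le.1 h).le

theorem cost_offline_le_pred {V : Type*} [Fintype V] (G : SimpleGraph V) (c ε : ℝ)
    (π : V ≃ Fin (Fintype.card V)) (B : V → V → Bool) :
    cost G (offline G c ε π B) ≤ cost G (truncatedPivotWithPred G c ε π B) := by
  unfold offline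
  split_ifs with h
  · exact h
  · exact le_rfl

/-- Coins with success probabilities `0` and `1` are deterministic. -/
theorem sum_tableProb_indicator {V : Type*} [Fintype V] (r : V → V → Prop)
    (F : (V → V → Bool) → ℝ) :
    ∑ B, tableProb (fun u v => if r u v then 1 else 0) B * F B =
      F fun u v => decide (r u v) := by
  rw [Finset.sum_eq_single fun u v => decide (r u v)]
  · have : tableProb (fun u v => if r u v then 1 else 0) (fun u v => decide (r u v)) = 1 := by
      unfold tableProb rowProb
      refine Finset.prod_eq_one fun u _ => Finset.prod_eq_one fun v _ => ?_
      by_cases h : r u v <;> simp [h]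
    rw [this, one_mul]
  · intro B _ hB
    obtain ⟨u, hu⟩ := Function.ne_iff.1 hB
    obtain ⟨v, hv⟩ := Function.ne_iff.1 hu
    have : tableProb (fun u v => if r u v then 1 else 0) B = 0 := by
      unfold tableProb rowProb
      refine Finset.prod_eq_zero (Finset.mem_univ u) (Finset.prod_eq_zero (Finset.mem_univ v) ?_)
      by_cases h : r u v
      · cases hb : B u v <;> simp_all
      · cases hb : B u v <;> simp_all
    rw [this, zero_mul]
  · simp

/-- `TruncatedPivot` uses no coins, so the real coins are averaged out and replaced by deterministic
ones, bringing it under the common analysis. -/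
theorem factorial_mul_expectedCost_le_pivot {V : Type*} [Fintype V] (G : SimpleGraph V) (c ε : ℝ)
    (d : Sym2 V → unitInterval) :
    (Fintype.card V).factorial * expectedCost G c ε d ≤
      expect (fun u v => if G.Adj u v then 1 else 0)
        (fun π B => (cost G (truncatedClustering G c ε π fun u v => B u v = true) : ℝ)) := by
  rw [factorial_mul_expectedCost]
  unfold expect
  refine Finset.sum_le_sum fun π _ => ?_
  rw [sum_tableProb_indicator (fun u v => G.Adj u v)]
  simp only [decide_eq_true_eq]
  have h := sum_tableProb (fun u v => 1 - rejectProb G d u v)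
  calc _ ≤ ∑ B, tableProb (fun u v => 1 - rejectProb G d u v) B *
        (cost G (truncatedPivot G c ε π) : ℝ) := by
        refine Finset.sum_le_sum fun B _ => mul_le_mul_of_nonneg_left ?_ (tableProb_nonneg
          (fun u v => sub_nonneg.2 (rejectProb_le_one G d u v))
          (fun u v => sub_le_self _ (rejectProb_nonneg G d u v)) B)
        exact_mod_cast cost_offline_le_pivot G c ε π B
    _ = _ := by rw [← Finset.sum_mul, h, one_mul]; rfl

theorem opt_le_expectedCost {V : Type*} [Fintype V] (G : SimpleGraph V) (c ε : ℝ)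
    (d : Sym2 V → unitInterval) : (opt G : ℝ) ≤ expectedCost G c ε d := by
  have hpos : (0 : ℝ) < (Fintype.card V).factorial := by positivity
  refine le_of_mul_le_mul_left ?_ hpos
  rw [factorial_mul_expectedCost, ← expect_const]
  refine expect_mono (fun u v => sub_nonneg.2 (rejectProb_le_one G d u v))
    (fun u v => sub_le_self _ (rejectProb_nonneg G d u v)) fun π B => ?_
  exact_mod_cast opt_le_cost G _

theorem expectedCost_le_pivot {V : Type*} [Fintype V] {G : SimpleGraph V} {c ε δ η : ℝ}
    {d : Sym2 V → unitInterval} (hδ : 0 ≤ δ) (hδ1 : δ ≤ 1 / 2) (hη0 : 0 ≤ η)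
    (hη : ∀ (u : V) (t : ℕ), t < Fintype.card V → ¬ Alive G (threshold V c ε) t u →
      Real.exp (-(δ * G.degree u / Fintype.card V * t)) ≤ η) :
    (1 - 2 * δ) * expectedCost G c ε d ≤ 3 * opt G + (Fintype.card V : ℝ) ^ 3 * η := by
  obtain ⟨C, hC⟩ := exists_cost_eq_opt G
  have hpos : (0 : ℝ) < (Fintype.card V).factorial := by positivity
  have h1 := (isRounding_pivot G C).expect_cost_le hδ (by linarith) hη0 hη
  have h2 := factorial_mul_expectedCost_le_pivot G c ε d
  have h3 : pairSum (lpWeight G fun u v => if C u v then (0 : ℝ) else 1) Finset.univ =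
      2 * (opt G : ℝ) := by
    rw [← hC, two_mul_cost, pairSum]
    refine Finset.sum_congr rfl fun u _ => Finset.sum_congr rfl fun v _ => ?_
    by_cases hC' : C u v <;> simp [lpWeight, err, hC']
  rw [h3] at h1
  have h4 := mul_le_mul_of_nonneg_left h2 (show 0 ≤ 1 - 2 * δ by linarith)
  refine le_of_mul_le_mul_left ?_ hpos
  linarith

theorem expectedCost_le_pred {V : Type*} [Fintype V] {G : SimpleGraph V} {c ε δ η β : ℝ}
    {d : Sym2 V → unitInterval} (hd : IsBetaLevel G β d) (hδ : 0 ≤ δ) (hδ1 : δ ≤ 1 / 2)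
    (hη0 : 0 ≤ η)
    (hη : ∀ (u : V) (t : ℕ), t < Fintype.card V → ¬ Alive G (threshold V c ε) t u →
      Real.exp (-(δ * G.degree u / Fintype.card V * t)) ≤ η) :
    (1 - 2 * δ) * expectedCost G c ε d ≤ 2.06 * β * opt G + (Fintype.card V : ℝ) ^ 3 * η := by
  have hpos : (0 : ℝ) < (Fintype.card V).factorial := by positivity
  have hr := isRounding_pred hd
  have h1 := hr.expect_cost_le hδ (by linarith) hη0 hη
  have h2 : (Fintype.card V).factorial * expectedCost G c ε d ≤ _ :=
    (factorial_mul_expectedCost G c ε d).trans_le (expect_mono hr.nonneg hr.le_one fun π B =>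
      Nat.cast_le.2 (cost_offline_le_pred G c ε π B))
  have h3 := two_mul_sum_add_sum G (fun e => (d e : ℝ))
  have h5 := hd.sum_le
  rw [pairSum, ← h3] at h1
  have h4 := mul_le_mul_of_nonneg_left h2 (show 0 ≤ 1 - 2 * δ by linarith)
  have h6 := mul_le_mul_of_nonneg_left h5 hpos.le
  refine le_of_mul_le_mul_left ?_ hpos
  unfold truncatedPivotWithPred at h4
  linarith

/-- A vertex that cannot be taken by the pivot at position `t` has seen enough pivots. -/
theorem exp_le_of_not_alive {V : Type*} [Fintype V] {G : SimpleGraph V} {c ε δ : ℝ} (hδ : 0 ≤ δ)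
    {u : V} {t : ℕ} (ht : t < Fintype.card V) (h : ¬ Alive G (threshold V c ε) t u) :
    Real.exp (-(δ * G.degree u / Fintype.card V * t)) ≤
      Real.exp (δ - δ * (c / ε * Real.log (Fintype.card V))) := by
  have hn : (0 : ℝ) < Fintype.card V := by exact_mod_cast (Nat.zero_le t).trans_lt ht
  have hdeg : (G.degree u : ℝ) ≤ Fintype.card V := by exact_mod_cast (G.degree_lt_card_verts u).le
  unfold Alive threshold at h
  rw [not_lt] at h
  refine Real.exp_le_exp.2 ?_
  -- Retirement bounds `(t + 1) * deg`, while survival involves only the `t` earlier steps. The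
  -- difference `deg / n ≤ 1` produces the summand `δ` in the exponent.
  have h1 : c / ε * Real.log (Fintype.card V) - 1 ≤ G.degree u / Fintype.card V * t := by
    rw [div_mul_eq_mul_div (G.degree u : ℝ), le_div_iff₀ hn]
    linarith
  have h2 := mul_le_mul_of_nonneg_left h1 hδ
  have h3 : δ * G.degree u / Fintype.card V * t = δ * (G.degree u / Fintype.card V * t) := by ring
  rw [h3]
  linarith

/-! ### Choosing the parameters `δ` and `η`. -/

theorem cost_eq_zero_of_card_le_one {V : Type*} [Fintype V] (G : SimpleGraph V) (C : Setoid V)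
    (h : Fintype.card V ≤ 1) : cost G C = 0 := by
  have := Fintype.card_le_one_iff_subsingleton.1 h
  have h1 : 2 * (cost G C : ℝ) = 0 := by
    rw [two_mul_cost]
    refine Finset.sum_eq_zero fun u _ => Finset.sum_eq_zero fun v _ => ?_
    simp [err, Subsingleton.elim u v]
  have h2 : (cost G C : ℝ) = 0 := by linarith
  exact_mod_cast h2

theorem expectedCost_le_of_opt_ne_zero {V : Type*} [Fintype V] {G : SimpleGraph V} {c ε β : ℝ}
    {d : Sym2 V → unitInterval} (hd : IsBetaLevel G β d) (hc : 200 ≤ c) (hε : 0 < ε)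
    (hε1 : ε < 1 / 4) (hopt : opt G ≠ 0) :
    expectedCost G c ε d ≤ (min (2.06 * β) 3 + ε) * opt G := by
  have hn : 2 ≤ Fintype.card V := by
    by_contra h
    obtain ⟨C, hC⟩ := exists_cost_eq_opt G
    exact hopt (hC ▸ cost_eq_zero_of_card_le_one G C (by omega))
  have hopt1 : (1 : ℝ) ≤ opt G := by exact_mod_cast Nat.one_le_iff_ne_zero.2 hopt
  have hn2 : (2 : ℝ) ≤ Fintype.card V := by exact_mod_cast hn
  have hn0 : (0 : ℝ) < Fintype.card V := by linarith
  -- This `η` makes `n^3 * η = ε / 2`, which is at most `(ε / 2) * OPT`. With `δ = ε / 20` the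
  -- exponent `δ * c / ε = c / 20` is at least `10`.
  have hη : ∀ (u : V) (t : ℕ), t < Fintype.card V → ¬ Alive G (threshold V c ε) t u →
      Real.exp (-(ε / 20 * G.degree u / Fintype.card V * t)) ≤
        ε / (2 * (Fintype.card V : ℝ) ^ 3) := by
    intro u t ht h
    have h1 := exp_le_of_not_alive (δ := ε / 20) (by positivity) ht h
    have hdeg : (G.degree u : ℝ) ≤ Fintype.card V := by
      exact_mod_cast (G.degree_lt_card_verts u).le
    have ht1 : (t : ℝ) + 1 ≤ Fintype.card V := by exact_mod_cast ht
    have hlog : 0.69 ≤ Real.log (Fintype.card V) := by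
      have := Real.log_le_log (by norm_num) hn2
      have := Real.log_two_gt_d9
      linarith
    -- If a vertex retires at all, then `(c/ε) log n ≤ n`. Thus `ε` is not too small compared with
    -- `1 / n`, and the power of `n` can beat the factor `ε` in `η`.
    have h2 : 1 ≤ ε * Fintype.card V := by
      unfold Alive threshold at h
      rw [not_lt] at h
      have h3 : ((t : ℝ) + 1) * (G.degree u : ℝ) ≤ Fintype.card V * Fintype.card V := by gcongr
      have h4 : c / ε * Real.log (Fintype.card V) ≤ Fintype.card V := by
        refine le_of_mul_le_mul_left ?_ hn0
        linarith
      rw [div_mul_eq_mul_div, div_le_iff₀ hε] at h4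
      nlinarith
    refine h1.trans ?_
    have e1 : ε / 20 - ε / 20 * (c / ε * Real.log (Fintype.card V)) =
        ε / 20 - c / 20 * Real.log (Fintype.card V) := by
      field_simp
    rw [e1]
    have h5 : Real.exp (ε / 20 - c / 20 * Real.log (Fintype.card V)) ≤
        Real.exp (1 - 10 * Real.log (Fintype.card V)) := by
      refine Real.exp_le_exp.2 ?_
      nlinarith
    refine h5.trans ?_
    have e2 : Real.exp (10 * Real.log (Fintype.card V)) = (Fintype.card V : ℝ) ^ 10 := by
      have := Real.exp_nat_mul (Real.log (Fintype.card V)) 10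
      rw [Real.exp_log hn0] at this
      simpa using this
    rw [Real.exp_sub, e2, div_le_div_iff₀ (by positivity) (by positivity)]
    have h6 : Real.exp 1 ≤ 3 := by linarith [Real.exp_one_lt_d9]
    have h7 : (2 : ℝ) ^ 6 ≤ (Fintype.card V : ℝ) ^ 6 := by gcongr
    calc Real.exp 1 * (2 * (Fintype.card V : ℝ) ^ 3)
        ≤ 2 ^ 6 * (Fintype.card V : ℝ) ^ 3 := by nlinarith [pow_pos hn0 3]
      _ ≤ (ε * Fintype.card V) * (Fintype.card V : ℝ) ^ 6 * (Fintype.card V : ℝ) ^ 3 := by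
          have : (Fintype.card V : ℝ) ^ 6 ≤ (ε * Fintype.card V) * (Fintype.card V : ℝ) ^ 6 :=
            le_mul_of_one_le_left (by positivity) h2
          gcongr
          linarith
      _ = ε * (Fintype.card V : ℝ) ^ 10 := by ring
  have hη0 : 0 ≤ ε / (2 * (Fintype.card V : ℝ) ^ 3) := by positivity
  have b1 := expectedCost_le_pred hd (show 0 ≤ ε / 20 by positivity) (by linarith) hη0 hη
  have b2 := expectedCost_le_pivot (d := d) (show 0 ≤ ε / 20 by positivity) (by linarith) hη0 hη
  have e3 : (Fintype.card V : ℝ) ^ 3 * (ε / (2 * (Fintype.card V : ℝ) ^ 3)) = ε / 2 := by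
    field_simp
  rw [e3] at b1 b2
  have final : ∀ ρ : ℝ, ρ ≤ 3 → (1 - 2 * (ε / 20)) * expectedCost G c ε d ≤ ρ * opt G + ε / 2 →
      expectedCost G c ε d ≤ (ρ + ε) * opt G := by
    intro ρ hρ h
    refine le_of_mul_le_mul_left (h.trans ?_) (show 0 < 1 - 2 * (ε / 20) by linarith)
    -- Dividing by `1 - ε/10` costs at most `ε (ρ + ε) / 10`, which is below `ε / 2` since `ρ ≤ 3`
    -- and `ε < 1/4`.
    have h8 : ρ + ε / 2 ≤ (1 - 2 * (ε / 20)) * (ρ + ε) := by nlinarith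
    have h9 := mul_le_mul_of_nonneg_right h8 (show (0 : ℝ) ≤ opt G by linarith)
    nlinarith
  rcases min_cases (2.06 * β) 3 with ⟨h, h'⟩ | ⟨h, h'⟩ <;> rw [h]
  · exact final _ h' b1
  · exact final _ le_rfl b2

theorem expectedCost_le_of_opt_eq_zero {V : Type*} [Fintype V] {G : SimpleGraph V} {c ε : ℝ}
    (d : Sym2 V → unitInterval) (hc : 200 ≤ c) (hε : 0 < ε) (hε1 : ε < 1 / 4) (hopt : opt G = 0) :
    expectedCost G c ε d ≤ (1 + 4 * ε) / (Fintype.card V : ℝ) ^ (c / 2 - 3) := by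
  rcases Nat.lt_or_ge (Fintype.card V) 2 with hn | hn
  · have : expectedCost G c ε d = 0 := by
      unfold expectedCost
      simp [cost_eq_zero_of_card_le_one G _ (Nat.le_of_lt_succ hn)]
    rw [this]
    positivity
  have hn2 : (2 : ℝ) ≤ Fintype.card V := by exact_mod_cast hn
  have hn0 : (0 : ℝ) < Fintype.card V := by linarith
  have hlog : 0.69 ≤ Real.log (Fintype.card V) := by
    have := Real.log_le_log (by norm_num) hn2
    have := Real.log_two_gt_d9
    linarith
  -- No multiplicative loss matters when the optimum is zero, so `δ` is a constant. Since `c / ε ≥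
  -- 4c`, the exponent is at least `c`; half of it is spare and yields the factor `1 / e`, which
  -- offsets the division by `1 - 2δ = 1/2`.
  have b := expectedCost_le_pivot (d := d) (G := G) (c := c) (ε := ε) (δ := 1 / 4) (by norm_num)
    (by norm_num) (Real.exp_pos _).le
    (fun u t ht h => exp_le_of_not_alive (δ := 1 / 4) (by norm_num) ht h)
  rw [hopt] at b
  have e3 : (Fintype.card V : ℝ) ^ 3 = Real.exp (3 * Real.log (Fintype.card V)) := by
    have := Real.exp_nat_mul (Real.log (Fintype.card V)) 3
    rw [Real.exp_log hn0] at this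
    simpa using this.symm
  rw [e3, ← Real.exp_add] at b
  have h1 : 4 * c ≤ c / ε := by
    rw [le_div_iff₀ hε]; nlinarith
  have h2 : Real.exp (3 * Real.log (Fintype.card V) +
      (1 / 4 - 1 / 4 * (c / ε * Real.log (Fintype.card V)))) ≤
      Real.exp ((3 - c / 2) * Real.log (Fintype.card V) - 1) := by
    refine Real.exp_le_exp.2 ?_
    nlinarith
  rw [Real.rpow_def_of_pos hn0, div_eq_mul_inv, ← Real.exp_neg]
  have h3 : Real.exp ((3 - c / 2) * Real.log (Fintype.card V) - 1) =
      Real.exp (-(Real.log (Fintype.card V) * (c / 2 - 3))) / Real.exp 1 := by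
    rw [← Real.exp_sub]; ring_nf
  have h4 : (2 : ℝ) ≤ Real.exp 1 := by linarith [Real.exp_one_gt_d9]
  have h5 := Real.exp_pos (-(Real.log (Fintype.card V) * (c / 2 - 3)))
  have h6 : Real.exp (-(Real.log (Fintype.card V) * (c / 2 - 3))) / Real.exp 1 ≤
      Real.exp (-(Real.log (Fintype.card V) * (c / 2 - 3))) / 2 := by gcongr
  push_cast at b
  nlinarith

end CorrClust

theorem mainTheorem5 :
    ∃ c₀ : ℝ, 0 < c₀ ∧ ∀ c : ℝ, c₀ ≤ c → ∀ ε : ℝ, 0 < ε → ε < 1 / 4 → ∀ β : ℝ, 1 ≤ β →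
      ∀ (V : Type*) [Fintype V] (G : SimpleGraph V) (d : Sym2 V → unitInterval),
        CorrClust.IsBetaLevel G β d →
          (CorrClust.opt G : ℝ) ≤ CorrClust.expectedCost G c ε d ∧
          (CorrClust.opt G ≠ 0 →
            CorrClust.expectedCost G c ε d ≤ (min (2.06 * β) 3 + ε) * (CorrClust.opt G : ℝ)) ∧
          (CorrClust.opt G = 0 →
            CorrClust.expectedCost G c ε d ≤
              (1 + 4 * ε) / (Fintype.card V : ℝ) ^ (c / 2 - 3)) := by
  refine ⟨200, by norm_num, fun c hc ε hε hε1 β _ V _ G d hd => ⟨?_, ?_, ?_⟩⟩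
  · exact CorrClust.opt_le_expectedCost G c ε d
  · exact CorrClust.expectedCost_le_of_opt_ne_zero hd hc hε hε1
  · exact CorrClust.expectedCost_le_of_opt_eq_zero d hc hε hε1
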